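/- Let $k\in\{2,3,\dots,\infty\}$ and let $(M,g)$ be a spacetime: $M$ is a connected Hausdorff paracompact manifold of class $C^{k+1}$ and finite dimension $n_0\ge 2$ (without boundary), $g$ is a $C^{k}$ Lorentzian metric on $M$ of signature $(-,+,\dots,+)$, and $(M,g)$ is time-oriented, i.e. at every point one of the two causal cones is chosen as the future cone, and near each point the chosen cones are those selected by some $C^k$ causal vector field. A tangent vector $v$ is timelike if $g(v,v)<0$ and causal if $g(v,v)\le 0$ and $v\ne 0$. A future-directed timelike (resp. causal) curve is a piecewise $C^{k+1}$ curve $\gamma:[a,b]\to M$, $a<b$, with finitely many pieces, all of whose tangent vectors, including both lateral ones at each break, are timelike (resp. causal) and lie in the future cone. For $p,q\in M$ write $p\ll q$ if some future-directed timelike curve connects $p$ with $q$; write $p\le q$ if $p=q$ or some future-directed causal curve connects $p$ with $q$; and write $p\to q$ (horismos) if $p\le q$ but not $p\ll q$. Write $x\le^{(\to)}y$ if there are $n\ge 1$ and points $x_1,\dots,x_n\in M$ with $x=x_1\to x_2\to\cdots\to x_n=y$ (for $n=1$ this means $x=y$). Suppose that $(M,g)$ is strongly causal: for every $p\in M$ and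 every neighborhood $U$ of $p$ there is a neighborhood $V\subset U$ of $p$ such that every future-directed causal curve with endpoints in $V$ is entirely contained in $U$. Theorem. For all $x,y\in M$, $$x\le^{(\to)}y\iff x\le y .$$ -/

import Mathlib

open Set Filter Topology Manifold Bundle
open scoped ContDiff

namespace Lorentz

/-- A Lorentzian metric of class `C^k` on the manifold `M` modelled on `E`: a `C^k` field of symmetric
bilinear forms of signature `(-, +, …, +)` on the tangent spaces. -/
structure LorentzianMetric (k : ℕ∞) (E : Type*) [NormedAddCommGroup E] [NormedSpace ℝ E]
    (M : Type*) [TopologicalSpace M] [ChartedSpace E M] [IsManifold 𝓘(ℝ, E) 1 M] where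
  /-- The scalar product on each tangent space. -/
  val (p : M) : TangentSpace 𝓘(ℝ, E) p →L[ℝ] TangentSpace 𝓘(ℝ, E) p →L[ℝ] ℝ
  symm (p : M) (v w : TangentSpace 𝓘(ℝ, E) p) : val p v w = val p w v
  /-- The signature is `(-, +, …, +)`: the form is negative on some vector and positive definite on
  the orthogonal complement of that vector. In particular it is nondegenerate. -/
  signature (p : M) : ∃ e : TangentSpace 𝓘(ℝ, E) p, val p e e < 0 ∧
    ∀ w : TangentSpace 𝓘(ℝ, E) p, val p e w = 0 → w ≠ 0 → 0 < val p w w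
  contMDiff : ContMDiff 𝓘(ℝ, E) (𝓘(ℝ, E).prod 𝓘(ℝ, E →L[ℝ] E →L[ℝ] ℝ)) k
    (fun p : M ↦ TotalSpace.mk' (E →L[ℝ] E →L[ℝ] ℝ)
      (E := fun p : M ↦ TangentSpace 𝓘(ℝ, E) p →L[ℝ] TangentSpace 𝓘(ℝ, E) p →L[ℝ] ℝ) p (val p))

section

variable {k : ℕ∞} {E : Type*} [NormedAddCommGroup E] [NormedSpace ℝ E]
  {M : Type*} [TopologicalSpace M] [ChartedSpace E M] [IsManifold 𝓘(ℝ, E) 1 M]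

namespace LorentzianMetric

/-- Timelike tangent vectors. -/
def IsTimelike (g : LorentzianMetric k E M) {p : M} (v : TangentSpace 𝓘(ℝ, E) p) : Prop :=
  g.val p v v < 0

/-- Causal tangent vectors: timelike or lightlike. -/
def IsCausal (g : LorentzianMetric k E M) {p : M} (v : TangentSpace 𝓘(ℝ, E) p) : Prop :=
  g.val p v v ≤ 0 ∧ v ≠ 0

/-- `C` is one of the two causal cones of the tangent space at `p`: the cone of all causal
vectors that lie on the same side as some timelike vector `w`. -/
def IsCausalCone (g : LorentzianMetric k E M) (p : M) (C : Set (TangentSpace 𝓘(ℝ, E) p)) : Prop :=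
  ∃ w : TangentSpace 𝓘(ℝ, E) p, g.IsTimelike w ∧ C = {v | g.IsCausal v ∧ g.val p w v < 0}

end LorentzianMetric

/-- A time-orientation: a choice of one of the two causal cones (the future cone) at each point,
which near each point is the cone selected by a `C^k` causal vector field. -/
structure TimeOrientation (g : LorentzianMetric k E M) where
  /-- The cone of future-directed causal vectors. -/
  future (p : M) : Set (TangentSpace 𝓘(ℝ, E) p)
  isCausalCone (p : M) : g.IsCausalCone p (future p)
  smooth (p : M) : ∃ U ∈ 𝓝 p, ∃ X : (q : M) → TangentSpace 𝓘(ℝ, E) q,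
    ContMDiffOn 𝓘(ℝ, E) 𝓘(ℝ, E).tangent k (fun q ↦ (⟨q, X q⟩ : TangentBundle 𝓘(ℝ, E) M)) U ∧
    ∀ q ∈ U, X q ∈ future q

/-- `γ` restricted to `[a, b]`, `a < b`, is a piecewise `C^r` curve all of whose tangent vectors
lie in the set `D`. There are finitely many pieces, and at a break both lateral tangent vectors
are required to lie in `D`. -/
def IsPiecewiseCurve (r : ℕ∞) (D : (p : M) → Set (TangentSpace 𝓘(ℝ, E) p))
    (γ : ℝ → M) (a b : ℝ) : Prop :=
  a < b ∧ ∃ (n : ℕ) (t : ℕ → ℝ), t 0 = a ∧ t n = b ∧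
    ∀ i < n, t i < t (i + 1) ∧
      ContMDiffOn 𝓘(ℝ, ℝ) 𝓘(ℝ, E) r γ (Icc (t i) (t (i + 1))) ∧
      ∀ s ∈ Icc (t i) (t (i + 1)),
        mfderivWithin 𝓘(ℝ, ℝ) 𝓘(ℝ, E) γ (Icc (t i) (t (i + 1))) s (1 : ℝ) ∈ D (γ s)

namespace TimeOrientation

variable {g : LorentzianMetric k E M} (T : TimeOrientation g)

/-- Future-directed causal curves `[a, b] → M` (piecewise `C^(k+1)`, the smoothness of `M`). -/
def IsCausalCurve (γ : ℝ → M) (a b : ℝ) : Prop :=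
  IsPiecewiseCurve (k + 1) T.future γ a b

/-- Future-directed timelike curves `[a, b] → M` (piecewise `C^(k+1)`, the smoothness of `M`). -/
def IsTimelikeCurve (γ : ℝ → M) (a b : ℝ) : Prop :=
  IsPiecewiseCurve (k + 1) (fun p ↦ {v | v ∈ T.future p ∧ g.IsTimelike v}) γ a b

/-- The chronological relation `p ≪ q`. -/
def Chron (p q : M) : Prop :=
  ∃ (γ : ℝ → M) (a b : ℝ), T.IsTimelikeCurve γ a b ∧ γ a = p ∧ γ b = q

/-- The causal relation `p ≤ q`: a future-directed causal curve, or a constant one, connects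
`p` with `q`. -/
def Causal (p q : M) : Prop :=
  p = q ∨ ∃ (γ : ℝ → M) (a b : ℝ), T.IsCausalCurve γ a b ∧ γ a = p ∧ γ b = q

/-- The horismos relation `p → q`, that is `E⁺ = J⁺ \ I⁺`. -/
def Horismos (p q : M) : Prop :=
  T.Causal p q ∧ ¬ T.Chron p q

/-- `x = x₁ → x₂ → ⋯ → xₙ = y` for some finite sequence of points. -/
def HorismosChain (x y : M) : Prop :=
  ∃ (n : ℕ) (z : ℕ → M), z 0 = x ∧ z n = y ∧ ∀ i < n, T.Horismos (z i) (z (i + 1))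

/-- Strong causality: each neighbourhood `U` of any point `p` contains a neighbourhood `V` of `p`
such that every future-directed causal curve with endpoints in `V` is contained in `U`. -/
def StronglyCausal : Prop :=
  ∀ p : M, ∀ U ∈ 𝓝 p, ∃ V ∈ 𝓝 p, V ⊆ U ∧
    ∀ (γ : ℝ → M) (a b : ℝ), T.IsCausalCurve γ a b → γ a ∈ V → γ b ∈ V →
      ∀ s ∈ Icc a b, γ s ∈ U

end TimeOrientation

end

end Lorentz

/-! A horismotic chain is causal because causal curves concatenate. Conversely, if `x ≤ y` without
`x ≪ y`, one horismotic step suffices, so the content is the case `x ≪ y`: a timelike curve has to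
be replaced by a chain. A supremum argument along each smooth piece
(`reflTransGen_of_isSmoothPiece`) reduces this to points of the curve near a given one
(`eventually_chain`).

Let `e` be the timelike tangent vector at that point. Two local facts are combined in a chart.

Reachability (`exists_null_chain`): `e` is a positive combination of null vectors `e ± c_j b_j`,
where the `b_j` form a basis of the orthogonal complement of `e`. Following null geodesics in these
directions one after another, for times depending linearly on a vector parameter, gives a map whose
derivative at the origin is the identity. Its local inverse pulls the curve back to one with tangent
`e`, so after the base point all flow times are positive and before it all are negative.

Achronality (`exists_monotone_function`): around each of these null geodesics there is an explicit
function that is constant on the geodesic and strictly decreases in future timelike directions, on a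
neighbourhood `U` that does not depend on the geodesic. Strong causality gives a smaller
neighbourhood such that causal curves with endpoints in it stay in `U`. A timelike curve between the
ends of a segment would then contradict monotonicity, so the ends are horismotically related
(`NullSegment.horismos`).

Geodesics are taken in Hamiltonian form, parametrized by a linear form `ℓ`. For a `C^2` metric the
field is `C^1`, and only differentiability of its flow at time zero is used; no normal
neighbourhoods are needed. -/

set_option maxSynthPendingDepth 3

/-! ### Flows of vector fields at time zero -/

namespace Lorentz

/-- The local flow of a `C^1` vector field is strictly differentiable at time zero. -/
theorem exists_flow_hasStrictFDerivAt {Z : Type*} [NormedAddCommGroup Z] [NormedSpace ℝ Z]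
    [CompleteSpace Z] {F : Z → Z} {z₀ : Z} (hF : ContDiffAt ℝ 1 F z₀) {W : Set Z} (hW : W ∈ 𝓝 z₀) :
    ∃ ε > 0, ∃ α : ℝ × Z → Z,
      HasStrictFDerivAt α (ContinuousLinearMap.snd ℝ ℝ Z +
        (ContinuousLinearMap.fst ℝ ℝ Z).smulRight (F z₀)) (0, z₀) ∧
      ∀ z ∈ Metric.ball z₀ ε, α (0, z) = z ∧ ∀ t ∈ Ioo (-ε) ε, α (t, z) ∈ W ∧
        HasDerivAt (fun t ↦ α (t, z)) (F (α (t, z))) t := by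
  obtain ⟨δ, hδ, a, r, L, K, hr, hpl⟩ := IsPicardLindelof.of_contDiffAt_one hF
  obtain ⟨β, hβ, L', hL'⟩ :=
    (hpl 0).exists_forall_mem_closedBall_eq_hasDerivWithinAt_lipschitzOnWith
  obtain ⟨K', s, hs, hK'⟩ := hF.exists_lipschitzOnWith
  have hcont : ContinuousOn (fun p : ℝ × Z ↦ β p.2 p.1)
      (Icc (0 - δ) (0 + δ) ×ˢ Metric.closedBall z₀ r) := by
    apply continuousOn_prod_of_continuousOn_lipschitzOnWith' _ L'
    · exact fun t ht ↦ hL' t ht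
    · intro z hz t ht
      exact ((hβ z hz).2 t ht).continuousWithinAt
  have hz₀ : β z₀ 0 = z₀ := (hβ z₀ (Metric.mem_closedBall_self r.2)).1
  have hnhds : Icc (0 - δ) (0 + δ) ×ˢ Metric.closedBall z₀ r ∈ 𝓝 ((0 : ℝ), z₀) :=
    prod_mem_nhds (Icc_mem_nhds (by linarith) (by linarith))
      (Metric.closedBall_mem_nhds _ (by exact_mod_cast hr))
  have hc : ContinuousAt (fun p : ℝ × Z ↦ β p.2 p.1) (0, z₀) := hcont.continuousAt hnhds
  have hsmall : ∀ W ∈ 𝓝 z₀, ∃ ε > 0, ε < δ ∧ ∀ z ∈ Metric.ball z₀ ε, β z 0 = z ∧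
      z ∈ Metric.closedBall z₀ r ∧
      ∀ t ∈ Ioo (-ε) ε, β z t ∈ W ∧ HasDerivAt (β z) (F (β z t)) t := by
    intro W hW
    have h1 : ∀ᶠ p in 𝓝 ((0 : ℝ), z₀), β p.2 p.1 ∈ W := hc (by simpa [hz₀] using hW)
    obtain ⟨ε, hε, h⟩ := Metric.eventually_nhds_iff_ball.1 (h1.and hnhds)
    refine ⟨min ε (δ / 2), by positivity, (min_le_right _ _).trans_lt (by linarith), fun z hz ↦ ?_⟩
    have hzε : dist z z₀ < ε := lt_of_lt_of_le hz (min_le_left _ _)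
    have hzr : z ∈ Metric.closedBall z₀ r :=
      (h (0, z) (by simpa [Prod.dist_eq, hε] using hzε)).2.2
    refine ⟨(hβ z hzr).1, hzr, fun t ht ↦ ?_⟩
    have ht1 : |t| < ε := (abs_lt.2 ht).trans_le (min_le_left _ _)
    have ht2 : |t| < δ := (abs_lt.2 ht).trans_le ((min_le_right _ _).trans (by linarith))
    rw [abs_lt] at ht2
    refine ⟨(h (t, z) (by simpa [Prod.dist_eq, hzε] using ht1)).1, ?_⟩
    exact ((hβ z hzr).2 t ⟨by linarith, by linarith⟩).hasDerivAt
      (Icc_mem_nhds (by linarith) (by linarith))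
  obtain ⟨ε, hε, -, h⟩ := hsmall W hW
  refine ⟨ε, hε, fun p ↦ β p.2 p.1, ?_, fun z hz ↦ ⟨(h z hz).1, (h z hz).2.2⟩⟩
  -- At time zero the variational equation is not needed: the increment is split into a change of
  -- time with `z` fixed (`e1`, continuity of `F`) and a change of initial point at time `t'` (`e2`,
  -- Lipschitz bounds, with an error proportional to `|t'|`).
  rw [hasStrictFDerivAt_iff_isLittleO, Asymptotics.isLittleO_iff]
  intro c hc0
  have hW1 : s ∩ {z | ‖F z - F z₀‖ < c / 2} ∈ 𝓝 z₀ := by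
    refine inter_mem hs ?_
    have : Tendsto (fun z ↦ ‖F z - F z₀‖) (𝓝 z₀) (𝓝 0) := by
      simpa using (hF.continuousAt.sub (continuousAt_const (y := F z₀))).norm.tendsto
    exact this.eventually (gt_mem_nhds (by positivity))
  obtain ⟨η, hη, hηδ, hη'⟩ := hsmall _ hW1
  set κ : ℝ := K' * L' with hκ
  have hκ0 : 0 ≤ κ := by positivity
  set θ := min η (c / 2 / (κ + 1)) with hθ
  have hθ0 : 0 < θ := by positivity
  have hθη : θ ≤ η := min_le_left _ _
  have hθκ : κ * θ ≤ c / 2 := by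
    have : θ ≤ c / 2 / (κ + 1) := min_le_right _ _
    rw [le_div_iff₀ (by positivity)] at this
    nlinarith
  have hball : Metric.ball ((0 : ℝ), z₀) θ ×ˢ Metric.ball ((0 : ℝ), z₀) θ ∈
      𝓝 (((0 : ℝ), z₀), ((0 : ℝ), z₀)) :=
    prod_mem_nhds (Metric.ball_mem_nhds _ hθ0) (Metric.ball_mem_nhds _ hθ0)
  filter_upwards [hball]
  rintro ⟨⟨t, z⟩, ⟨t', z'⟩⟩ ⟨hp, hq⟩
  simp only [Metric.mem_ball, Prod.dist_eq, max_lt_iff, dist_zero_right, Real.norm_eq_abs] at hp hq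
  have hz := hη' z (hp.2.trans_le hθη)
  have hz' := hη' z' (hq.2.trans_le hθη)
  have hIoo : ∀ {x : ℝ}, x ∈ Ioo (-θ) θ → x ∈ Ioo (-η) η := fun hx ↦
    ⟨by linarith [hx.1], by linarith [hx.2]⟩
  have htI : t ∈ Ioo (-θ) θ := abs_lt.1 hp.1
  have htI' : t' ∈ Ioo (-θ) θ := abs_lt.1 hq.1
  have e1 : ‖(β z t - t • F z₀) - (β z t' - t' • F z₀)‖ ≤ c / 2 * ‖t - t'‖ := by
    refine (convex_Ioo (-θ) θ).norm_image_sub_le_of_norm_hasDerivWithin_le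
      (f := fun x ↦ β z x - x • F z₀) (f' := fun x ↦ F (β z x) - (1 : ℝ) • F z₀)
      (fun x hx ↦ ?_) (fun x hx ↦ ?_) htI' htI
    · exact (((hz.2.2 x (hIoo hx)).2).sub ((hasDerivAt_id x).smul_const _)).hasDerivWithinAt
    · simpa using (hz.2.2 x (hIoo hx)).1.2.le
  have e2 : ‖(β z t' - β z' t') - (β z 0 - β z' 0)‖ ≤ κ * ‖z - z'‖ * ‖t' - 0‖ := by
    refine (convex_Ioo (-θ) θ).norm_image_sub_le_of_norm_hasDerivWithin_le
      (f := fun x ↦ β z x - β z' x) (f' := fun x ↦ F (β z x) - F (β z' x))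
      (fun x hx ↦ ?_) (fun x hx ↦ ?_) ⟨by linarith, hθ0⟩ htI'
    · exact (((hz.2.2 x (hIoo hx)).2).sub (hz'.2.2 x (hIoo hx)).2).hasDerivWithinAt
    · have a1 := hK'.dist_le_mul _ (hz.2.2 x (hIoo hx)).1.1 _ (hz'.2.2 x (hIoo hx)).1.1
      have a2 := (hL' x ⟨by linarith [hx.1], by linarith [hx.2]⟩).dist_le_mul z hz.2.1 z' hz'.2.1
      rw [dist_eq_norm, dist_eq_norm] at a1 a2
      calc _ ≤ _ := a1
        _ ≤ K' * (L' * ‖z - z'‖) := by gcongr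
        _ = _ := by rw [hκ]; ring
  rw [hz.1, hz'.1, sub_zero] at e2
  have n1 : ‖t - t'‖ ≤ ‖((t, z) : ℝ × Z) - (t', z')‖ := norm_fst_le (((t, z) : ℝ × Z) - (t', z'))
  have n2 : ‖z - z'‖ ≤ ‖((t, z) : ℝ × Z) - (t', z')‖ := norm_snd_le (((t, z) : ℝ × Z) - (t', z'))
  have e3 : κ * ‖z - z'‖ * ‖t'‖ ≤ c / 2 * ‖z - z'‖ := by
    have : ‖t'‖ ≤ θ := hq.1.le
    calc κ * ‖z - z'‖ * ‖t'‖ ≤ κ * ‖z - z'‖ * θ := by gcongr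
      _ = κ * θ * ‖z - z'‖ := by ring
      _ ≤ _ := by gcongr
  calc _ = ‖((β z t - t • F z₀) - (β z t' - t' • F z₀)) + ((β z t' - β z' t') - (z - z'))‖ := by
        congr 1
        simp [sub_smul]
        abel
    _ ≤ _ := norm_add_le _ _
    _ ≤ c / 2 * ‖((t, z) : ℝ × Z) - (t', z')‖ + c / 2 * ‖((t, z) : ℝ × Z) - (t', z')‖ := by
        refine add_le_add (e1.trans (by gcongr)) ((e2.trans e3).trans (by gcongr))
    _ = _ := by ring

end Lorentz

/-! ### Lorentzian metrics in coordinates: regularity and uniform estimates -/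

namespace Lorentz

/-- A field `g` of symmetric bilinear forms of class `C^k` on an open set `O` of a vector space,
Lorentzian at `x₀`, with a vector `e`, timelike at `x₀`, and the linear form `ℓ` that vanishes on its
orthogonal complement and takes the value one at `e`. -/
structure IsLocalMetric {E : Type*} [NormedAddCommGroup E] [NormedSpace ℝ E] (k : ℕ∞)
    (g : E → E →L[ℝ] E →L[ℝ] ℝ) (O : Set E) (x₀ : E) (ℓ : E →L[ℝ] ℝ) (e : E) : Prop where
  isOpen : IsOpen O
  mem : x₀ ∈ O
  contDiffOn : ContDiffOn ℝ k g O
  symm (x v w : E) : g x v w = g x w v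
  pos (v : E) : ℓ v = 0 → v ≠ 0 → 0 < g x₀ v v
  neg : g x₀ e e < 0
  apply_eq_one : ℓ e = 1
  orthogonal (v : E) : ℓ v = 0 → g x₀ e v = 0

/-- The Hamiltonian vector field of null geodesics, parametrized by the linear form `ℓ`. -/
noncomputable def nullField {E : Type*} [NormedAddCommGroup E] [NormedSpace ℝ E]
    (g : E → E →L[ℝ] E →L[ℝ] ℝ) (ℓ : E →L[ℝ] ℝ) (z : E × (E →L[ℝ] ℝ)) : E × (E →L[ℝ] ℝ) :=
  ((ℓ ((g z.1).inverse z.2))⁻¹ • (g z.1).inverse z.2,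
    (2 * ℓ ((g z.1).inverse z.2))⁻¹ •
      ((fderiv ℝ g z.1).flip ((g z.1).inverse z.2)).flip ((g z.1).inverse z.2))

/-- A positive definite continuous bilinear form on a finite-dimensional subspace is coercive. -/
theorem exists_coercive {E : Type*} [NormedAddCommGroup E] [NormedSpace ℝ E]
    [FiniteDimensional ℝ E] (q : E →L[ℝ] E →L[ℝ] ℝ) (ℓ : E →L[ℝ] ℝ)
    (hq : ∀ v, ℓ v = 0 → v ≠ 0 → 0 < q v v) :
    ∃ c > 0, ∀ v, ℓ v = 0 → c * ‖v‖ ^ 2 ≤ q v v := by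
  have hK : IsCompact (Metric.sphere (0 : E) 1 ∩ {v | ℓ v = 0}) :=
    (isCompact_sphere _ _).inter_right (isClosed_eq ℓ.continuous continuous_const)
  have hcont : Continuous fun v ↦ q v v := by fun_prop
  rcases (Metric.sphere (0 : E) 1 ∩ {v | ℓ v = 0}).eq_empty_or_nonempty with h | h
  · refine ⟨1, one_pos, fun v hv ↦ ?_⟩
    have : v = 0 := by
      by_contra hv0
      have : (‖v‖⁻¹ • v) ∈ Metric.sphere (0 : E) 1 ∩ {v | ℓ v = 0} :=
        ⟨by simp [norm_smul, hv0], by simp [hv]⟩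
      simp [h] at this
    simp [this]
  · obtain ⟨v₀, hv₀, hmin⟩ := hK.exists_isMinOn h hcont.continuousOn
    have hv₀0 : v₀ ≠ 0 := by
      rintro rfl
      simpa using hv₀.1
    refine ⟨q v₀ v₀, hq v₀ hv₀.2 hv₀0, fun v hv ↦ ?_⟩
    rcases eq_or_ne v 0 with rfl | hv0
    · simp
    have hmem : (‖v‖⁻¹ • v) ∈ Metric.sphere (0 : E) 1 ∩ {v | ℓ v = 0} :=
      ⟨by simp [norm_smul, hv0], by simp [hv]⟩
    have := hmin hmem
    simp only [mem_ofPred_eq, map_smul, smul_eq_mul, smul_apply] at this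
    have hn : 0 < ‖v‖ := norm_pos_iff.2 hv0
    calc q v₀ v₀ * ‖v‖ ^ 2 ≤ (‖v‖⁻¹ * (‖v‖⁻¹ * q v v)) * ‖v‖ ^ 2 := by gcongr
      _ = q v v := by field_simp

theorem isInvertible_of_injective {E : Type*} [NormedAddCommGroup E] [NormedSpace ℝ E]
    [FiniteDimensional ℝ E] (q : E →L[ℝ] E →L[ℝ] ℝ) (hq : Function.Injective q) :
    q.IsInvertible := by
  have h : Module.finrank ℝ E = Module.finrank ℝ (E →L[ℝ] ℝ) := by
    rw [← (LinearMap.toContinuousLinearMap (𝕜 := ℝ) (E := E) (F' := ℝ)).finrank_eq]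
    exact Subspace.dual_finrank_eq.symm
  refine ⟨(LinearEquiv.ofInjectiveOfFinrankEq (q : E →ₗ[ℝ] E →L[ℝ] ℝ) hq
    h).toContinuousLinearEquiv, ?_⟩
  ext v w
  rfl

theorem eventually_isInvertible {E F : Type*} [NormedAddCommGroup E] [NormedSpace ℝ E]
    [NormedAddCommGroup F] [NormedSpace ℝ F] [CompleteSpace E]
    {q : E →L[ℝ] F} (hq : q.IsInvertible) : ∀ᶠ q' in 𝓝 q, q'.IsInvertible := by
  obtain ⟨e, rfl⟩ := hq
  filter_upwards [e.nhds] with q' hq'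
  exact hq'

section

variable {E : Type*} [NormedAddCommGroup E] [NormedSpace ℝ E] [FiniteDimensional ℝ E]
  {g : E → E →L[ℝ] E →L[ℝ] ℝ} {O : Set E} {x₀ : E} {ℓ : E →L[ℝ] ℝ} {e : E}

/-- Pairing a kernel vector with `e` shows that it lies in the kernel of `ℓ`, where the form is
positive definite. -/
theorem IsLocalMetric.isInvertible {k : ℕ∞} (h : IsLocalMetric k g O x₀ ℓ e) :
    (g x₀).IsInvertible := by
  refine isInvertible_of_injective _ ((injective_iff_map_eq_zero _).2 fun v hv ↦ ?_)
  have h1 : ℓ (v - ℓ v • e) = 0 := by simp [h.apply_eq_one]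
  have h2 := h.orthogonal _ h1
  have h3 : g x₀ e v = 0 := by rw [h.symm, hv]; rfl
  have h4 : ℓ v * g x₀ e e = 0 := by simpa [h3] using h2
  have h5 : ℓ v = 0 := (mul_eq_zero.1 h4).resolve_right h.neg.ne
  by_contra h6
  exact (h.pos v h5 h6).ne' (by simp [hv])

theorem contDiffAt_inverse_apply {n : WithTop ℕ∞} {z : E × (E →L[ℝ] ℝ)}
    (hg : ContDiffAt ℝ n g z.1) (hi : (g z.1).IsInvertible) :
    ContDiffAt ℝ n (fun z : E × (E →L[ℝ] ℝ) ↦ (g z.1).inverse z.2) z := by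
  have : ContDiffAt ℝ n (fun x ↦ (g x).inverse) z.1 :=
    hi.contDiffAt_map_inverse.comp z.1 hg
  exact (this.comp z contDiffAt_fst).clm_apply contDiffAt_snd

/-- The position component contains the metric but not its derivative, so it is one degree smoother
than the full field. This extra degree makes the null geodesics `C^(k+1)`, as causal curves must be.
-/
theorem contDiffAt_nullField_fst {n : WithTop ℕ∞} {z : E × (E →L[ℝ] ℝ)}
    (hg : ContDiffAt ℝ n g z.1) (hi : (g z.1).IsInvertible)
    (hℓ : ℓ ((g z.1).inverse z.2) ≠ 0) :
    ContDiffAt ℝ n (fun z ↦ (nullField g ℓ z).1) z := by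
  have := contDiffAt_inverse_apply hg hi
  exact ((ℓ.contDiff.contDiffAt.comp z this).inv hℓ).smul this

theorem contDiffAt_nullField {n : WithTop ℕ∞} {z : E × (E →L[ℝ] ℝ)}
    (hg : ContDiffAt ℝ (n + 1) g z.1) (hi : (g z.1).IsInvertible)
    (hℓ : ℓ ((g z.1).inverse z.2) ≠ 0) :
    ContDiffAt ℝ n (nullField g ℓ) z := by
  have hg' : ContDiffAt ℝ n g z.1 := hg.of_le le_self_add
  have h1 := contDiffAt_inverse_apply hg' hi
  have h2 : ContDiffAt ℝ n (fun z : E × (E →L[ℝ] ℝ) ↦ fderiv ℝ g z.1) z :=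
    ContDiffAt.comp (g := fderiv ℝ g) z (hg.fderiv_right le_rfl) contDiffAt_fst
  have h3 : ContDiffAt ℝ n (fun z : E × (E →L[ℝ] ℝ) ↦
      ((fderiv ℝ g z.1).flip ((g z.1).inverse z.2)).flip ((g z.1).inverse z.2)) z := by
    have a1 := (((ContinuousLinearMap.flipₗᵢ ℝ E E (E →L[ℝ] ℝ)).contDiff.contDiffAt.comp z
      h2).clm_apply h1)
    exact (((ContinuousLinearMap.flipₗᵢ ℝ E E ℝ).contDiff.contDiffAt.comp z a1).clm_apply h1)
  have h4 : ContDiffAt ℝ n (fun z : E × (E →L[ℝ] ℝ) ↦ (2 * ℓ ((g z.1).inverse z.2))⁻¹) z :=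
    (contDiffAt_const.mul (ℓ.contDiff.contDiffAt.comp z h1)).inv (by simpa using hℓ)
  exact (contDiffAt_nullField_fst hg' hi hℓ).prodMk (h4.smul h3)

/-- Uniform estimates for a Lorentzian metric near a point. -/
theorem IsLocalMetric.exists_bounds {k : ℕ∞} (hk : 2 ≤ k) (h : IsLocalMetric k g O x₀ ℓ e) :
    ∃ r > 0, ∃ K > 0, ∃ c > 0, Metric.ball x₀ r ⊆ O ∧
      (∀ x ∈ Metric.ball x₀ r, (g x).IsInvertible ∧ ∀ v, ℓ v = 0 → c * ‖v‖ ^ 2 ≤ g x v v) ∧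
      ‖g x₀‖ ≤ K ∧
      ∀ x ∈ Metric.ball x₀ r, ∀ y ∈ Metric.ball x₀ r,
        ‖g x - g y‖ ≤ K * ‖x - y‖ ∧ ‖g x - g y - fderiv ℝ g y (x - y)‖ ≤ K * ‖x - y‖ ^ 2 := by
  have hg : ContDiffAt ℝ 2 g x₀ :=
    (h.contDiffOn.contDiffAt (h.isOpen.mem_nhds h.mem)).of_le (WithTop.coe_le_coe.2 hk)
  obtain ⟨c, hc, hcoer⟩ := exists_coercive (g x₀) ℓ h.pos
  obtain ⟨K₁, s₁, hs₁, hK₁⟩ := (hg.of_le one_le_two).exists_lipschitzOnWith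
  obtain ⟨K₂, s₂, hs₂, hK₂⟩ :=
    (hg.fderiv_right (m := 1) (by norm_num)).exists_lipschitzOnWith
  have hnear : ∀ᶠ x in 𝓝 x₀, ‖g x - g x₀‖ < c / 2 := by
    have : Tendsto (fun x ↦ ‖g x - g x₀‖) (𝓝 x₀) (𝓝 0) := by
      simpa using (hg.continuousAt.sub (continuousAt_const (y := g x₀))).norm.tendsto
    exact this.eventually (gt_mem_nhds (by positivity))
  have hinv : ∀ᶠ x in 𝓝 x₀, (g x).IsInvertible :=
    hg.continuousAt.eventually (eventually_isInvertible h.isInvertible)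
  obtain ⟨r, hr, hball⟩ := Metric.eventually_nhds_iff_ball.1
    (hnear.and (hinv.and ((h.isOpen.eventually_mem h.mem).and
      ((eventually_mem_set.2 hs₁).and (eventually_mem_set.2 hs₂)))))
  refine ⟨r, hr, max (max K₁ K₂) (‖g x₀‖ + 1), lt_max_of_lt_right (by positivity), c / 2,
    by positivity, fun x hx ↦ (hball x hx).2.2.1, fun x hx ↦ ⟨(hball x hx).2.1, fun v hv ↦ ?_⟩,
    le_max_of_le_right (by linarith), fun x hx y hy ↦ ⟨?_, ?_⟩⟩
  · have h1 := hcoer v hv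
    have h2 : ‖(g x - g x₀) v v‖ ≤ c / 2 * ‖v‖ * ‖v‖ :=
      (ContinuousLinearMap.le_opNorm₂ _ v v).trans (by gcongr; exact (hball x hx).1.le)
    have h3 := (abs_le.1 h2).1
    simp only [sub_apply] at h3
    nlinarith
  · have := hK₁.dist_le_mul x (hball x hx).2.2.2.1 y (hball y hy).2.2.2.1
    rw [dist_eq_norm, dist_eq_norm] at this
    exact this.trans (by gcongr; exact (le_max_left _ _).trans (le_max_left _ _))
  -- Second-order Taylor bound from a Lipschitz derivative: on this convex set the derivative of `g`
  -- differs from that at `y` by at most `K₂ * ‖x - y‖`.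
  · have hconv : Convex ℝ (Metric.ball x₀ r ∩ Metric.closedBall y ‖x - y‖) :=
      (convex_ball _ _).inter (convex_closedBall _ _)
    have := hconv.norm_image_sub_le_of_norm_hasFDerivWithin_le' (f := g) (f' := fderiv ℝ g)
      (φ := fderiv ℝ g y) (C := K₂ * ‖x - y‖) (x := y) (y := x) (fun w hw ↦ ?_) (fun w hw ↦ ?_)
      ⟨hy, by simp⟩ ⟨hx, by simp [dist_eq_norm]⟩
    · refine this.trans ?_
      rw [mul_assoc, ← pow_two]
      gcongr
      exact (le_max_right _ _).trans (le_max_left _ _)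
    · refine HasFDerivAt.hasFDerivWithinAt (DifferentiableAt.hasFDerivAt ?_)
      refine ((h.contDiffOn.contDiffAt
        (h.isOpen.mem_nhds (hball w hw.1).2.2.1)).differentiableAt ?_)
      have : (k : WithTop ℕ∞) ≠ 0 := by
        have : k ≠ 0 := by rintro rfl; simp at hk
        exact_mod_cast this
      exact this
    · have h1 := hK₂.dist_le_mul w (hball w hw.1).2.2.2.2 y (hball y hy).2.2.2.2
      rw [dist_eq_norm] at h1
      exact h1.trans (by gcongr; exact hw.2)

end

/-- The pointwise estimate behind the local achronality of null geodesics. -/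
theorem monotone_estimate {K c m s a b A gp gz gb qz qb : ℝ} (hK : 0 < K) (hc : 0 < c)
    (hm : 1 / 2 ≤ m) (hm' : m ≤ 2) (ha : 0 ≤ a) (hb : 0 ≤ b)
    (hs : |s| * ((2 * K ^ 3 + (4 * K ^ 2 + 2 * K) ^ 2 / (2 * c)) / c) ≤ 1)
    (hneg : A + gp + 2 * gz + gb < 0) (hgp : |gp| ≤ K ^ 3 * a ^ 2) (hgz : |gz| ≤ K ^ 2 * (a * b))
    (hgb : c * b ^ 2 ≤ gb) (hqz : c * a ^ 2 ≤ qz) (hqb : |qb| ≤ K * (a * b)) :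
    m * A - (2 * K ^ 3 + (4 * K ^ 2 + 2 * K) ^ 2 / (2 * c)) / c * (qz + 2 * s * qb) < 0 := by
  set C := (2 * K ^ 3 + (4 * K ^ 2 + 2 * K) ^ 2 / (2 * c)) / c with hC
  have hC0 : 0 < C := by positivity
  have hab : 0 ≤ a * b := by positivity
  have hA : A < K ^ 3 * a ^ 2 + 2 * (K ^ 2 * (a * b)) - c * b ^ 2 := by
    linarith [(abs_le.1 hgp).1, (abs_le.1 hgz).1]
  have h1 : m * A < m * (K ^ 3 * a ^ 2 + 2 * (K ^ 2 * (a * b)) - c * b ^ 2) :=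
    mul_lt_mul_of_pos_left hA (by linarith)
  have h2 : m * (K ^ 3 * a ^ 2 + 2 * (K ^ 2 * (a * b))) ≤
      2 * (K ^ 3 * a ^ 2 + 2 * (K ^ 2 * (a * b))) :=
    mul_le_mul_of_nonneg_right hm' (by positivity)
  have h3 : 1 / 2 * (c * b ^ 2) ≤ m * (c * b ^ 2) :=
    mul_le_mul_of_nonneg_right hm (by positivity)
  have h4 : C * (c * a ^ 2) ≤ C * qz := mul_le_mul_of_nonneg_left hqz hC0.le
  have h5 : |C * (2 * s * qb)| ≤ 2 * (K * (a * b)) := by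
    calc |C * (2 * s * qb)| = 2 * ((|s| * C) * |qb|) := by
          rw [abs_mul, abs_mul, abs_mul, abs_of_pos hC0, abs_two]; ring
      _ ≤ 2 * (1 * (K * (a * b))) := by gcongr
      _ = _ := by ring
  have h6 : C * (c * a ^ 2) = 2 * K ^ 3 * a ^ 2 + (4 * K ^ 2 + 2 * K) ^ 2 / (2 * c) * a ^ 2 := by
    rw [hC]; field_simp
  -- Completing the square absorbs all mixed terms. Half of `c * b ^ 2` is available because `m ≥ 1
  -- / 2`, and `C` is chosen so that `C * (c * a ^ 2)` pays exactly for the terms in `a ^ 2`.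
  have h7 : (4 * K ^ 2 + 2 * K) * (a * b) ≤
      (4 * K ^ 2 + 2 * K) ^ 2 / (2 * c) * a ^ 2 + c / 2 * b ^ 2 := by
    have : 0 ≤ ((4 * K ^ 2 + 2 * K) * a - c * b) ^ 2 / (2 * c) := by positivity
    have e : ((4 * K ^ 2 + 2 * K) * a - c * b) ^ 2 / (2 * c) =
      (4 * K ^ 2 + 2 * K) ^ 2 / (2 * c) * a ^ 2 + c / 2 * b ^ 2
        - (4 * K ^ 2 + 2 * K) * (a * b) := by field_simp; ring
    linarith
  linarith [(abs_le.1 h5).1]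

end Lorentz

/-! ### Null geodesics and the monotone function along them -/

namespace Lorentz

/-- A null curve from `y` to `y'` inside `O`, parametrized by `ℓ`, whose endpoints have the same
value under a function that strictly decreases along timelike directions of `U`. -/
def NullSegment {E : Type*} [NormedAddCommGroup E] [NormedSpace ℝ E] (k : ℕ∞)
    (g : E → E →L[ℝ] E →L[ℝ] ℝ) (ℓ : E →L[ℝ] ℝ) (O U : Set E) (y y' : E) : Prop :=
  ∃ (σ : ℝ → E) (a b : ℝ), a < b ∧ σ a = y ∧ σ b = y' ∧
    ContDiffOn ℝ (k + 1 : ℕ∞) σ (Icc a b) ∧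
    (∀ t ∈ Icc a b, σ t ∈ O ∧ ∃ v, HasDerivAt σ v t ∧ g (σ t) v v = 0 ∧ ℓ v = 1) ∧
    ∃ u : E → ℝ, u y = u y' ∧ ∀ x ∈ U, ∃ u' : E →L[ℝ] ℝ, HasFDerivAt u u' x ∧
      ∀ v, 0 < ℓ v → g x v v < 0 → u' v < 0

section

variable {E : Type*} [NormedAddCommGroup E] [NormedSpace ℝ E]
  {g : E → E →L[ℝ] E →L[ℝ] ℝ} {O : Set E} {x₀ : E} {ℓ : E →L[ℝ] ℝ} {e : E}
  {α : ℝ → E × (E →L[ℝ] ℝ)} {ε : ℝ}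

/-- A function with zero derivative on an open interval around zero is constant there. -/
theorem eq_of_hasDerivAt_zero_Ioo {F : Type*} [NormedAddCommGroup F] [NormedSpace ℝ F]
    {f : ℝ → F} {ε : ℝ} (hf : ∀ t ∈ Ioo (-ε) ε, HasDerivAt f 0 t) {t : ℝ} (ht : t ∈ Ioo (-ε) ε) :
    f t = f 0 := by
  have h0 : (0 : ℝ) ∈ Ioo (-ε) ε := ⟨by linarith [ht.1, ht.2], by linarith [ht.1, ht.2]⟩
  have := (convex_Ioo (-ε) ε).norm_image_sub_le_of_norm_hasDerivWithin_le (f := f)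
    (f' := fun _ ↦ 0) (C := 0) (fun x hx ↦ (hf x hx).hasDerivWithinAt) (by simp) h0 ht
  rw [zero_mul] at this
  exact sub_eq_zero.1 (norm_le_zero_iff.1 this)

theorem hasDerivAt_fst {F G : Type*} [NormedAddCommGroup F] [NormedSpace ℝ F]
    [NormedAddCommGroup G] [NormedSpace ℝ G] {f : ℝ → F × G} {f' : F × G} {t : ℝ}
    (hf : HasDerivAt f f' t) : HasDerivAt (fun t ↦ (f t).1) f'.1 t :=
  (ContinuousLinearMap.fst ℝ F G).hasFDerivAt.comp_hasDerivAt t hf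

theorem hasDerivAt_snd {F G : Type*} [NormedAddCommGroup F] [NormedSpace ℝ F]
    [NormedAddCommGroup G] [NormedSpace ℝ G] {f : ℝ → F × G} {f' : F × G} {t : ℝ}
    (hf : HasDerivAt f f' t) : HasDerivAt (fun t ↦ (f t).2) f'.2 t :=
  (ContinuousLinearMap.snd ℝ F G).hasFDerivAt.comp_hasDerivAt t hf

theorem apply_inverse {q : E →L[ℝ] E →L[ℝ] ℝ} (hq : q.IsInvertible) (η : E →L[ℝ] ℝ) :
    q (q.inverse η) = η := by
  obtain ⟨q, rfl⟩ := hq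
  simp

/-- The parameter of a solution of the null geodesic equation is the linear form `ℓ`. -/
theorem nullField_solution_parameter
    (hα : ∀ t ∈ Ioo (-ε) ε, HasDerivAt α (nullField g ℓ (α t)) t)
    (hℓ : ∀ t ∈ Ioo (-ε) ε, ℓ ((g (α t).1).inverse (α t).2) ≠ 0) {t : ℝ} (ht : t ∈ Ioo (-ε) ε) :
    ℓ (α t).1 = ℓ (α 0).1 + t := by
  have := eq_of_hasDerivAt_zero_Ioo (f := fun t ↦ ℓ (α t).1 - t) (ε := ε) (fun t ht ↦ ?_) ht
  · simp only [sub_zero] at this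
    linarith
  · have := (ℓ.hasFDerivAt.comp_hasDerivAt t (hasDerivAt_fst (hα t ht))).sub (hasDerivAt_id t)
    convert! this using 1
    simp [nullField, hℓ t ht]

/-- The Hamiltonian is conserved along solutions of the null geodesic equation. -/
theorem nullField_solution_null [FiniteDimensional ℝ E]
    (hsymm : ∀ x v w : E, g x v w = g x w v)
    (hα : ∀ t ∈ Ioo (-ε) ε, HasDerivAt α (nullField g ℓ (α t)) t)
    (hg : ∀ t ∈ Ioo (-ε) ε, ContDiffAt ℝ 1 g (α t).1)
    (hi : ∀ t ∈ Ioo (-ε) ε, (g (α t).1).IsInvertible) {t : ℝ} (ht : t ∈ Ioo (-ε) ε) :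
    (α t).2 ((g (α t).1).inverse (α t).2) = (α 0).2 ((g (α 0).1).inverse (α 0).2) := by
  refine eq_of_hasDerivAt_zero_Ioo (f := fun t ↦ (α t).2 ((g (α t).1).inverse (α t).2)) (ε := ε)
    (fun t ht ↦ ?_) ht
  set w : ℝ → E := fun t ↦ (g (α t).1).inverse (α t).2 with hw
  have hwd : HasDerivAt w (deriv w t) t := by
    refine DifferentiableAt.hasDerivAt ?_
    exact ((contDiffAt_inverse_apply (hg t ht) (hi t ht)).differentiableAt one_ne_zero).comp
      t (hα t ht).differentiableAt
  have hx := hasDerivAt_fst (hα t ht)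
  have hω := hasDerivAt_snd (hα t ht)
  have hgx : HasDerivAt (fun t ↦ g (α t).1) (fderiv ℝ g (α t).1 (nullField g ℓ (α t)).1) t :=
    ((hg t ht).differentiableAt one_ne_zero).hasFDerivAt.comp_hasDerivAt t hx
  have h1 := hgx.clm_apply hwd
  have heq : (fun t ↦ g (α t).1 (w t)) =ᶠ[𝓝 t] fun t ↦ (α t).2 := by
    filter_upwards [Ioo_mem_nhds ht.1 ht.2] with s hs
    exact apply_inverse (hi s hs) _
  have h2 := (h1.congr_of_eventuallyEq heq.symm).unique hω
  have h3 := hω.clm_apply hwd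
  convert! h3 using 1
  -- Differentiating `g(x) w = ω` and evaluating at `w` eliminates `w'`: the derivative of `ω(w)`
  -- becomes `2 ω'(w) - (∂g)(x')(w, w)`, which vanishes because of the factor one half in the
  -- equation for `ω'`.
  have h4 := congrArg (fun q : E →L[ℝ] ℝ ↦ q (w t)) h2
  have h5 : g (α t).1 (w t) = (α t).2 := heq.eq_of_nhds
  simp only [add_apply] at h4
  rw [hsymm _ (deriv w t), h5] at h4
  have h6 : (nullField g ℓ (α t)).1 = (ℓ (w t))⁻¹ • w t := rfl
  have h7 : (nullField g ℓ (α t)).2 (w t) =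
    (2 * ℓ (w t))⁻¹ * fderiv ℝ g (α t).1 (w t) (w t) (w t) := rfl
  rw [h6, map_smul, smul_apply, smul_apply, smul_eq_mul] at h4
  rw [mul_inv] at h7
  linarith

/-- Regularity of null geodesics. -/
theorem nullField_solution_contDiffOn [FiniteDimensional ℝ E] {j : ℕ∞}
    (hα : ∀ t ∈ Ioo (-ε) ε, HasDerivAt α (nullField g ℓ (α t)) t)
    (hg : ∀ t ∈ Ioo (-ε) ε, ContDiffAt ℝ (j + 1 : ℕ∞) g (α t).1)
    (hi : ∀ t ∈ Ioo (-ε) ε, (g (α t).1).IsInvertible)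
    (hℓ : ∀ t ∈ Ioo (-ε) ε, ℓ ((g (α t).1).inverse (α t).2) ≠ 0) :
    ContDiffOn ℝ ((j + 1 : ℕ∞) + 1 : ℕ∞) (fun t ↦ (α t).1) (Ioo (-ε) ε) := by
  have hF : ∀ t ∈ Ioo (-ε) ε, ContDiffAt ℝ j (nullField g ℓ) (α t) := fun t ht ↦
    contDiffAt_nullField (by exact_mod_cast hg t ht) (hi t ht) (hℓ t ht)
  have hsucc : ∀ n : ℕ∞, n ≤ j → ContDiffOn ℝ n α (Ioo (-ε) ε) →
      ContDiffOn ℝ (n + 1 : ℕ∞) α (Ioo (-ε) ε) := by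
    intro n hn h
    push_cast
    rw [contDiffOn_succ_iff_deriv_of_isOpen isOpen_Ioo]
    refine ⟨fun t ht ↦ (hα t ht).differentiableAt.differentiableWithinAt, by simp, ?_⟩
    refine ContDiffOn.congr (f := fun t ↦ nullField g ℓ (α t)) (fun t ht ↦ ?_)
      fun t ht ↦ (hα t ht).deriv
    exact ((hF t ht).of_le (by exact_mod_cast hn)).comp_contDiffWithinAt t (h t ht)
  -- The bootstrap runs over natural numbers so that `j = ∞` is covered as well.
  have hnat : ∀ n : ℕ, (n : ℕ∞) ≤ j → ContDiffOn ℝ (n : ℕ∞) α (Ioo (-ε) ε) := by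
    intro n
    induction n with
    | zero =>
      intro _
      refine contDiffOn_zero.2 fun t ht ↦ (hα t ht).continuousAt.continuousWithinAt
    | succ n ih =>
      intro hn
      have hn' : (n : ℕ∞) ≤ j := le_trans (by exact_mod_cast n.le_succ) hn
      exact_mod_cast hsucc n hn' (ih hn')
  have hjα : ContDiffOn ℝ j α (Ioo (-ε) ε) := by
    rw [contDiffOn_iff_forall_nat_le]
    exact fun m hm ↦ by exact_mod_cast hnat m (by exact_mod_cast hm)
  have hj1 := hsucc j le_rfl hjα
  rw [show ((((j + 1 : ℕ∞) + 1 : ℕ∞)) : WithTop ℕ∞) = ((j + 1 : ℕ∞) : WithTop ℕ∞) + 1 from rfl,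
    contDiffOn_succ_iff_deriv_of_isOpen isOpen_Ioo]
  refine ⟨fun t ht ↦ (hasDerivAt_fst (hα t ht)).differentiableAt.differentiableWithinAt,
    by simp, ?_⟩
  refine ContDiffOn.congr (f := fun t ↦ (nullField g ℓ (α t)).1) (fun t ht ↦ ?_)
    fun t ht ↦ (hasDerivAt_fst (hα t ht)).deriv
  exact (contDiffAt_nullField_fst (hg t ht) (hi t ht) (hℓ t ht)).comp_contDiffWithinAt t (hj1 t ht)

/-- A neighbourhood of a null geodesic carries a function that is constant on the geodesic and
strictly decreases in timelike directions. -/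
theorem exists_monotone_function (hsymm : ∀ x v w : E, g x v w = g x w v)
    (hα : ∀ t ∈ Ioo (-ε) ε, HasDerivAt α (nullField g ℓ (α t)) t)
    {B : Set E} {Q : E →L[ℝ] E →L[ℝ] ℝ} {K c : ℝ} (hK : 0 < K) (hc : 0 < c)
    (hB : ∀ x ∈ B, (g x).IsInvertible ∧ ∀ v, ℓ v = 0 → c * ‖v‖ ^ 2 ≤ g x v v)
    (hgK : ∀ x ∈ B, ∀ y ∈ B,
      ‖g x - g y‖ ≤ K * ‖x - y‖ ∧ ‖g x - g y - fderiv ℝ g y (x - y)‖ ≤ K * ‖x - y‖ ^ 2)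
    (hQsymm : ∀ v w, Q v w = Q w v) (hQc : ∀ v, ℓ v = 0 → c * ‖v‖ ^ 2 ≤ Q v v) (hQK : ‖Q‖ ≤ K)
    (hαB : ∀ t ∈ Ioo (-ε) ε, (α t).1 ∈ B ∧ 1 / 2 ≤ ℓ ((g (α t).1).inverse (α t).2) ∧
      ℓ ((g (α t).1).inverse (α t).2) ≤ 2 ∧ ‖(nullField g ℓ (α t)).1‖ ≤ K ∧
      (α t).2 ((g (α t).1).inverse (α t).2) = 0) :
    ∃ u : E → ℝ, (∀ t ∈ Ioo (-ε) ε, u (α t).1 = 0) ∧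
      ∀ x ∈ B, |ℓ x - ℓ (α 0).1| < ε →
        |ℓ x - ℓ (α 0).1| * ((2 * K ^ 3 + (4 * K ^ 2 + 2 * K) ^ 2 / (2 * c)) / c) ≤ 1 →
        ∃ u' : E →L[ℝ] ℝ, HasFDerivAt u u' x ∧ ∀ v, 0 < ℓ v → g x v v < 0 → u' v < 0 := by
  set C := (2 * K ^ 3 + (4 * K ^ 2 + 2 * K) ^ 2 / (2 * c)) / c with hC
  have hℓ0 : ∀ t ∈ Ioo (-ε) ε, ℓ ((g (α t).1).inverse (α t).2) ≠ 0 := fun t ht ↦ by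
    linarith [(hαB t ht).2.1] |> fun h : 0 < ℓ ((g (α t).1).inverse (α t).2) ↦ h.ne'
  set y := (α 0).1 with hy
  set z : E → E := fun x ↦ x - (α (ℓ x - ℓ y)).1 with hz
  -- Here `z x`, in the kernel of `ℓ`, is the displacement from the geodesic point with the same
  -- value of `ℓ`. On the geodesic the differential is twice the null momentum, negative on future
  -- timelike vectors. Off the geodesic the error is quadratic in `z`; differentiating the factor `ℓ
  -- x - ℓ y` yields `-C * Q z z`, which dominates it.
  refine ⟨fun x ↦ 2 * (α (ℓ x - ℓ y)).2 (z x) - C * (ℓ x - ℓ y) * Q (z x) (z x), ?_, ?_⟩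
  · intro t ht
    have h1 : ℓ (α t).1 - ℓ y = t := by
      rw [nullField_solution_parameter hα hℓ0 ht]; ring
    have h2 : z (α t).1 = 0 := by simp only [hz, h1, sub_self]
    simp [h2]
  intro x hx hxε hxC
  set s := ℓ x - ℓ y with hs
  have hsI : s ∈ Ioo (-ε) ε := abs_lt.1 hxε
  set p := (nullField g ℓ (α s)).1 with hp
  set w := (g (α s).1).inverse (α s).2 with hw
  set m := ℓ w with hm
  obtain ⟨hσB, hm1, hm2, hpK, hnull⟩ := hαB s hsI
  have hm0 : 0 < m := by linarith
  have hwp : w = m • p := by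
    have : p = m⁻¹ • w := rfl
    rw [this, smul_inv_smul₀ hm0.ne']
  have hℓp : ℓ p = 1 := by
    have : p = m⁻¹ • w := rfl
    rw [this, map_smul, smul_eq_mul, ← hm, inv_mul_cancel₀ hm0.ne']
  have hω : (α s).2 = g (α s).1 w := (apply_inverse (hB _ hσB).1 _).symm
  have hpp : g (α s).1 p p = 0 := by
    rw [← hw, hω, hwp] at hnull
    simpa [hm0.ne'] using hnull
  have hω' : ∀ v, (nullField g ℓ (α s)).2 v = m / 2 * fderiv ℝ g (α s).1 v p p := by
    intro v
    have : (nullField g ℓ (α s)).2 v = (2 * m)⁻¹ * fderiv ℝ g (α s).1 v w w := rfl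
    rw [this, hwp]
    simp only [map_smul, smul_apply, smul_eq_mul]
    field_simp
  have hS : HasFDerivAt (fun x ↦ ℓ x - ℓ y) ℓ x := ℓ.hasFDerivAt.sub_const _
  have hσ' : HasFDerivAt (fun x ↦ (α (ℓ x - ℓ y)).1) (ℓ.smulRight p) x := by
    convert! (hasDerivAt_fst (hα s hsI)).hasFDerivAt.comp x hS using 1
  have hη' : HasFDerivAt (fun x ↦ (α (ℓ x - ℓ y)).2)
      (ℓ.smulRight (nullField g ℓ (α s)).2) x := by
    convert! (hasDerivAt_snd (hα s hsI)).hasFDerivAt.comp x hS using 1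
  have hZ : HasFDerivAt z (ContinuousLinearMap.id ℝ E - ℓ.smulRight p) x :=
    (hasFDerivAt_id x).sub hσ'
  have hQZ := (Q.hasFDerivAt.comp x hZ).clm_apply hZ
  refine ⟨_, ((hη'.clm_apply hZ).const_mul 2).sub ((hS.const_mul C).mul hQZ), fun v hv hvneg ↦ ?_⟩
  -- By homogeneity `v` may be compared with the geodesic velocity `p` after scaling both to `ℓ =
  -- 1`; the difference is then in the kernel of `ℓ`.
  set ζ := (ℓ v)⁻¹ • v - p with hζ
  have hvζ : v = ℓ v • (p + ζ) := by
    rw [hζ, add_sub_cancel, smul_inv_smul₀ hv.ne']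
  have hvp : v - ℓ v • p = ℓ v • ζ := by
    rw [hζ, smul_sub, smul_inv_smul₀ hv.ne']
  have hζ0 : ℓ ζ = 0 := by
    rw [hζ, map_sub, map_smul, smul_eq_mul, inv_mul_cancel₀ hv.ne', hℓp, sub_self]
  have hz0 : ℓ (z x) = 0 := by
    have := nullField_solution_parameter hα hℓ0 hsI
    simp only [hz, map_sub]
    rw [← hs, this, hs]; ring
  have hxz : x - (α s).1 = z x := rfl
  obtain ⟨hg1, hg2⟩ := hgK x hx _ hσB
  rw [hxz] at hg1 hg2
  set D := fderiv ℝ g (α s).1 (z x) with hD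
  have hneg : g x (p + ζ) (p + ζ) < 0 := by
    rw [hvζ] at hvneg
    simp only [map_smul, smul_apply, smul_eq_mul] at hvneg
    by_contra hcon
    push Not at hcon
    have : 0 ≤ ℓ v * (ℓ v * g x (p + ζ) (p + ζ)) := by positivity
    linarith
  -- `A` is chosen so that `2 (ω'(z) + ω(ζ)) = m A`, by the geodesic equation. It is also the
  -- leading part of `g x (p + ζ) (p + ζ)`, whose Taylor remainders are `gp` and `gz`.
  have key := monotone_estimate (K := K) (c := c) (m := m) (s := s) (a := ‖z x‖) (b := ‖ζ‖)
    (A := D p p + 2 * g (α s).1 p ζ) (gp := g x p p - D p p)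
    (gz := g x p ζ - g (α s).1 p ζ) (gb := g x ζ ζ) (qz := Q (z x) (z x)) (qb := Q (z x) ζ)
    hK hc hm1 hm2 (norm_nonneg _) (norm_nonneg _) hxC ?_ ?_ ?_ ((hB x hx).2 ζ hζ0) (hQc _ hz0) ?_
  · rw [← hC] at key
    have h1 : (nullField g ℓ (α s)).2 (z x) = m / 2 * D p p := hω' (z x)
    have h2 : (α s).2 ζ = m * g (α s).1 p ζ := by rw [hω, hwp]; simp
    have h3 : ((2 : ℝ) • ((α (ℓ x - ℓ y)).2.comp (ContinuousLinearMap.id ℝ E - ℓ.smulRight p) +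
        (ℓ.smulRight (nullField g ℓ (α s)).2).flip (z x)) -
        ((C * (ℓ x - ℓ y)) • ((((⇑Q ∘ z) x).comp (ContinuousLinearMap.id ℝ E - ℓ.smulRight p)) +
        (Q.comp (ContinuousLinearMap.id ℝ E - ℓ.smulRight p)).flip (z x)) +
        ((⇑Q ∘ z) x) (z x) • (C • ℓ))) v =
        ℓ v * (m * (D p p + 2 * g (α s).1 p ζ) - C * (Q (z x) (z x) + 2 * s * Q (z x) ζ)) := by
      simp only [sub_apply, add_apply, smul_apply, ContinuousLinearMap.comp_apply,
        ContinuousLinearMap.flip_apply, ContinuousLinearMap.smulRight_apply,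
        ContinuousLinearMap.id_apply, Function.comp_apply, smul_eq_mul, hvp, map_smul, h1]
      rw [← hs, h2, hQsymm ζ]
      ring
    exact h3.trans_lt (mul_neg_of_pos_of_neg hv key)
  · have : g x (p + ζ) (p + ζ) = g x p p + 2 * g x p ζ + g x ζ ζ := by
      simp only [map_add, add_apply]
      rw [hsymm x ζ p]; ring
    linarith
  · have h1 : g x p p - D p p = (g x - g (α s).1 - D) p p := by
      simp only [sub_apply, hpp]; ring
    rw [h1, ← Real.norm_eq_abs]
    calc _ ≤ _ := ContinuousLinearMap.le_opNorm₂ _ _ _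
      _ ≤ K * ‖z x‖ ^ 2 * K * K := by gcongr
      _ = _ := by ring
  · have h1 : g x p ζ - g (α s).1 p ζ = (g x - g (α s).1) p ζ := by simp only [sub_apply]
    rw [h1, ← Real.norm_eq_abs]
    calc _ ≤ _ := ContinuousLinearMap.le_opNorm₂ _ _ _
      _ ≤ K * ‖z x‖ * K * ‖ζ‖ := by gcongr
      _ = _ := by ring
  · rw [← Real.norm_eq_abs]
    calc _ ≤ _ := ContinuousLinearMap.le_opNorm₂ _ _ _
      _ ≤ K * ‖z x‖ * ‖ζ‖ := by gcongr
      _ = _ := by ring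

end

end Lorentz

/-! ### The flow along a field of null directions -/

namespace Lorentz

section

variable {E : Type*} [NormedAddCommGroup E] [NormedSpace ℝ E]
  {g : E → E →L[ℝ] E →L[ℝ] ℝ} {O : Set E} {x₀ : E} {ℓ : E →L[ℝ] ℝ} {e : E}

/-- A null vector at a point extends to a differentiable field of null vectors near the point. -/
theorem IsLocalMetric.exists_null_extension {k : ℕ∞} (hk : 1 ≤ k)
    (h : IsLocalMetric k g O x₀ ℓ e) {n : E} (hn : g x₀ n n = 0) (hℓn : ℓ n = 1) :
    ∃ N : E → E, N x₀ = n ∧ ContDiffAt ℝ 1 N x₀ ∧ ∀ᶠ y in 𝓝 x₀, g y (N y) (N y) = 0 := by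
  have hg : ContDiffAt ℝ 1 g x₀ :=
    (h.contDiffOn.contDiffAt (h.isOpen.mem_nhds h.mem)).of_le (WithTop.coe_le_coe.2 hk)
  set d := n - e with hd
  have hℓd : ℓ d = 0 := by rw [hd, map_sub, hℓn, h.apply_eq_one, sub_self]
  have hed := h.orthogonal d hℓd
  have hsum : g x₀ d d = -g x₀ e e := by
    have h1 : n = e + d := by rw [hd]; abel
    rw [h1] at hn
    simp only [map_add, add_apply] at hn
    rw [h.symm _ d e, hed] at hn
    linarith
  have hdd : 0 < g x₀ d d := by linarith [h.neg]
  have hsm : ∀ v w : E, ContDiffAt ℝ 1 (fun y ↦ g y v w) x₀ := fun v w ↦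
    (hg.clm_apply contDiffAt_const).clm_apply contDiffAt_const
  set disc : E → ℝ := fun y ↦ g y e d ^ 2 - g y d d * g y e e with hdisc
  have hdisc0 : disc x₀ = g x₀ d d ^ 2 := by
    simp only [hdisc, hed]
    linear_combination (-(g x₀ d d)) * hsum
  have hdiscs : ContDiffAt ℝ 1 disc x₀ := ((hsm e d).pow 2).sub ((hsm d d).mul (hsm e e))
  -- Root of the quadratic equation saying that `e + ρ • d` is null. At `x₀`, `e` and `d` are
  -- orthogonal, so the discriminant is the positive square `g x₀ d d ^ 2` and this root equals `1`,
  -- recovering `n`.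
  set ρ : E → ℝ := fun y ↦ (-g y e d + √(disc y)) / g y d d with hρ
  have hρ0 : ρ x₀ = 1 := by
    simp only [hρ, hed, hdisc0, Real.sqrt_sq hdd.le]
    field_simp
    simp
  have hρs : ContDiffAt ℝ 1 ρ x₀ :=
    ((hsm e d).neg.add (hdiscs.sqrt (by rw [hdisc0]; positivity))).div (hsm d d) hdd.ne'
  refine ⟨fun y ↦ e + ρ y • d, by simp [hρ0, hd], contDiffAt_const.add (hρs.smul contDiffAt_const),
    ?_⟩
  have e1 : ∀ᶠ y in 𝓝 x₀, 0 < g y d d := (hsm d d).continuousAt.eventually (lt_mem_nhds hdd)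
  have e2 : ∀ᶠ y in 𝓝 x₀, 0 < disc y := hdiscs.continuousAt.eventually
    (lt_mem_nhds (by rw [hdisc0]; positivity))
  filter_upwards [e1, e2] with y h1 h2
  have h3 : g y d d * ρ y + g y e d = √(disc y) := by simp only [hρ]; field_simp; ring
  have h4 : (g y d d * ρ y + g y e d) ^ 2 = g y e d ^ 2 - g y d d * g y e e := by
    rw [h3, Real.sq_sqrt h2.le]
  have h5 : g y d d * (g y e e + 2 * ρ y * g y e d + ρ y ^ 2 * g y d d) = 0 := by
    linear_combination h4
  have h6 := (mul_eq_zero.1 h5).resolve_left h1.ne'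
  simp only [map_add, add_apply, map_smul, smul_apply, smul_eq_mul]
  rw [h.symm y d e]
  linear_combination h6

/-- Following null geodesics that start in a fixed null direction. -/
theorem IsLocalMetric.exists_null_flow [FiniteDimensional ℝ E] {k : ℕ∞} (hk : 2 ≤ k)
    (h : IsLocalMetric k g O x₀ ℓ e) {n : E} (hn : g x₀ n n = 0) (hℓn : ℓ n = 1) :
    ∃ φ : ℝ × E → E, φ (0, x₀) = x₀ ∧
      HasStrictFDerivAt φ (ContinuousLinearMap.snd ℝ ℝ E +
        (ContinuousLinearMap.fst ℝ ℝ E).smulRight n) (0, x₀) ∧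
      ∃ U ∈ 𝓝 x₀, ∀ᶠ p in 𝓝 ((0 : ℝ), x₀),
        (0 < p.1 → NullSegment k g ℓ O U p.2 (φ p)) ∧
        (p.1 < 0 → NullSegment k g ℓ O U (φ p) p.2) := by
  obtain ⟨j, rfl⟩ : ∃ j : ℕ∞, k = j + 1 :=
    ⟨k - 1, (tsub_add_cancel_of_le (le_trans one_le_two hk)).symm⟩
  have hj : 1 ≤ j := by
    have : (1 : ℕ∞) + 1 ≤ j + 1 := by rwa [one_add_one_eq_two]
    exact (ENat.add_le_add_iff_right ENat.one_ne_top).1 this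
  obtain ⟨r, hr, K₀, hK₀, c, hc, hrO, hball, hQK, hgK⟩ := h.exists_bounds hk
  obtain ⟨N, hN0, hNs, hNnull⟩ := h.exists_null_extension (le_trans one_le_two hk) hn hℓn
  have hgat : ∀ x ∈ O, ContDiffAt ℝ (j + 1 : ℕ∞) g x := fun x hx ↦
    h.contDiffOn.contDiffAt (h.isOpen.mem_nhds hx)
  -- The same constant must also strictly bound the velocity `n`, so that it bounds the velocities
  -- of nearby geodesics.
  set K := max K₀ (‖n‖ + 1) with hKdef
  have hK : 0 < K := lt_max_of_lt_left hK₀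
  have hgK' : ∀ x ∈ Metric.ball x₀ r, ∀ y ∈ Metric.ball x₀ r,
      ‖g x - g y‖ ≤ K * ‖x - y‖ ∧ ‖g x - g y - fderiv ℝ g y (x - y)‖ ≤ K * ‖x - y‖ ^ 2 :=
    fun x hx y hy ↦ ⟨(hgK x hx y hy).1.trans (by gcongr; exact le_max_left _ _),
      (hgK x hx y hy).2.trans (by gcongr; exact le_max_left _ _)⟩
  set z₀ : E × (E →L[ℝ] ℝ) := (x₀, g x₀ n) with hz₀
  have hinv₀ : (g x₀).inverse (g x₀ n) = n := by
    obtain ⟨q, hq⟩ := h.isInvertible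
    rw [← hq]; simp
  have hnf₀ : (nullField g ℓ z₀).1 = n := by simp [nullField, hz₀, hinv₀, hℓn]
  have hx₀r : x₀ ∈ Metric.ball x₀ r := Metric.mem_ball_self hr
  have hG : ContDiffAt ℝ (j + 1 : ℕ∞) (fun z : E × (E →L[ℝ] ℝ) ↦ (g z.1).inverse z.2) z₀ :=
    contDiffAt_inverse_apply (hgat x₀ h.mem) h.isInvertible
  have hℓ₀ : ℓ ((g z₀.1).inverse z₀.2) ≠ 0 := by simp [hz₀, hinv₀, hℓn]
  have hFs : ContDiffAt ℝ j (nullField g ℓ) z₀ :=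
    contDiffAt_nullField (by exact_mod_cast hgat x₀ h.mem) h.isInvertible hℓ₀
  have hW : {z : E × (E →L[ℝ] ℝ) | z.1 ∈ Metric.ball x₀ r ∧
      ℓ ((g z.1).inverse z.2) ∈ Ioo (1 / 2) 2 ∧ ‖(nullField g ℓ z).1‖ < K} ∈ 𝓝 z₀ := by
    have w1 : ∀ᶠ z in 𝓝 z₀, z.1 ∈ Metric.ball x₀ r :=
      continuousAt_fst.eventually (Metric.ball_mem_nhds _ hr)
    have w2 : ∀ᶠ z in 𝓝 z₀, ℓ ((g z.1).inverse z.2) ∈ Ioo (1 / 2 : ℝ) 2 := by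
      refine (ℓ.continuous.continuousAt.comp hG.continuousAt).eventually (Ioo_mem_nhds ?_ ?_) <;>
      simp only [hz₀, Function.comp_apply, hinv₀, hℓn] <;> norm_num
    have w3 : ∀ᶠ z in 𝓝 z₀, ‖(nullField g ℓ z).1‖ < K := by
      refine (continuous_norm.continuousAt.comp (continuousAt_fst.comp
        hFs.continuousAt)).eventually (gt_mem_nhds ?_)
      simp only [Function.comp_apply, hnf₀, hKdef]
      exact lt_max_of_lt_right (by linarith)
    filter_upwards [w1, w2, w3] with z h1 h2 h3 using ⟨h1, h2, h3⟩
  obtain ⟨ε, hε, α, hαs, hα⟩ := exists_flow_hasStrictFDerivAt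
    (hFs.of_le (by exact_mod_cast hj)) hW
  -- The geodesic from `y` starts with the covector dual to `N y`, which makes it null for every
  -- nearby `y`.
  have hinit : HasStrictFDerivAt (fun y ↦ (y, g y (N y)))
      ((ContinuousLinearMap.id ℝ E).prod (fderiv ℝ (fun y ↦ g y (N y)) x₀)) x₀ := by
    refine (hasStrictFDerivAt_id x₀).prodMk ?_
    refine ContDiffAt.hasStrictFDerivAt (n := 1) ?_ one_ne_zero
    exact ((hgat x₀ h.mem).of_le (by exact_mod_cast le_add_self)).clm_apply hNs
  have hinit0 : (x₀, g x₀ (N x₀)) = z₀ := by rw [hN0]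
  have hφ : HasStrictFDerivAt (fun p : ℝ × E ↦ (p.1, (p.2, g p.2 (N p.2))))
      ((ContinuousLinearMap.fst ℝ ℝ E).prod
        (((ContinuousLinearMap.id ℝ E).prod (fderiv ℝ (fun y ↦ g y (N y)) x₀)).comp
          (ContinuousLinearMap.snd ℝ ℝ E))) (0, x₀) :=
    hasStrictFDerivAt_fst.prodMk (HasStrictFDerivAt.comp (g := fun y ↦ (y, g y (N y)))
      (f := Prod.snd) ((0 : ℝ), x₀) hinit hasStrictFDerivAt_snd)
  refine ⟨fun p ↦ (α (p.1, (p.2, g p.2 (N p.2)))).1, ?_, ?_, ?_⟩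
  · simp only [hinit0]
    rw [(hα z₀ (Metric.mem_ball_self hε)).1]
  · have hαs' : HasStrictFDerivAt α (ContinuousLinearMap.snd ℝ ℝ (E × (E →L[ℝ] ℝ)) +
        (ContinuousLinearMap.fst ℝ ℝ (E × (E →L[ℝ] ℝ))).smulRight (nullField g ℓ z₀))
        ((0 : ℝ), (x₀, g x₀ (N x₀))) := by rwa [hinit0]
    have := hasStrictFDerivAt_fst.comp ((0 : ℝ), x₀)
      (hαs'.comp (f := fun p : ℝ × E ↦ (p.1, (p.2, g p.2 (N p.2)))) ((0 : ℝ), x₀) hφ)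
    refine this.congr_fderiv ?_
    ext v <;> simp [hnf₀]
  set C := (2 * K ^ 3 + (4 * K ^ 2 + 2 * K) ^ 2 / (2 * c)) / c with hC
  have hC0 : 0 < C := by positivity
  -- `θ ≤ ε` keeps the geodesic defined over the needed range of `ℓ`, and `θ ≤ 1 / C` is the
  -- smallness condition of `exists_monotone_function`. Allowing `θ / 2` each for the points of `U`
  -- and for the starting point makes `U` independent of the latter.
  set θ := min ε (1 / C) with hθ
  have hθ0 : 0 < θ := by positivity
  have hnear : ∀ᶠ x in 𝓝 x₀, |ℓ x - ℓ x₀| < θ / 2 := by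
    have : Tendsto (fun x ↦ |ℓ x - ℓ x₀|) (𝓝 x₀) (𝓝 0) := by
      simpa using ((ℓ.continuous.continuousAt (x := x₀)).sub
        (continuousAt_const (y := ℓ x₀))).abs.tendsto
    exact this.eventually (gt_mem_nhds (by positivity))
  refine ⟨Metric.ball x₀ r ∩ {x | |ℓ x - ℓ x₀| < θ / 2},
    inter_mem (Metric.ball_mem_nhds _ hr) hnear, ?_⟩
  have ev1 : ∀ᶠ p in 𝓝 ((0 : ℝ), x₀), p.1 ∈ Ioo (-ε) ε :=
    continuousAt_fst.eventually (Ioo_mem_nhds (by simpa using hε) (by simpa using hε))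
  have ev2 : ∀ᶠ p in 𝓝 ((0 : ℝ), x₀), |ℓ p.2 - ℓ x₀| < θ / 2 :=
    continuousAt_snd.eventually (p := fun x ↦ |ℓ x - ℓ x₀| < θ / 2) hnear
  have ev3 : ∀ᶠ p in 𝓝 ((0 : ℝ), x₀), g p.2 (N p.2) (N p.2) = 0 :=
    continuousAt_snd.eventually (p := fun x ↦ g x (N x) (N x) = 0) hNnull
  have hzball : ∀ᶠ y in 𝓝 x₀, (y, g y (N y)) ∈ Metric.ball z₀ ε :=
    hinit.continuousAt.eventually (p := fun z ↦ z ∈ Metric.ball z₀ ε)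
      (by beta_reduce; rw [hinit0]; exact Metric.ball_mem_nhds _ hε)
  have ev4 : ∀ᶠ p in 𝓝 ((0 : ℝ), x₀), (p.2, g p.2 (N p.2)) ∈ Metric.ball z₀ ε :=
    continuousAt_snd.eventually (p := fun y ↦ (y, g y (N y)) ∈ Metric.ball z₀ ε) hzball
  have ev5 : ∀ᶠ p in 𝓝 ((0 : ℝ), x₀), p.2 ∈ Metric.ball x₀ r :=
    continuousAt_snd.eventually (Metric.ball_mem_nhds _ hr)
  filter_upwards [ev1, ev2, ev3, ev4, ev5]
  rintro ⟨s, y⟩ hs hy hnull hz hyr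
  simp only at hs hy hnull hz hyr
  obtain ⟨hα0, hαt⟩ := hα _ hz
  set β : ℝ → E × (E →L[ℝ] ℝ) := fun t ↦ α (t, (y, g y (N y))) with hβ
  have hβ0 : β 0 = (y, g y (N y)) := hα0
  have hinvβ : ∀ t ∈ Ioo (-ε) ε, (g (β t).1).IsInvertible := fun t ht ↦
    (hball _ (hαt t ht).1.1).1
  have hβd : ∀ t ∈ Ioo (-ε) ε, HasDerivAt β (nullField g ℓ (β t)) t := fun t ht ↦ (hαt t ht).2
  have hβg : ∀ t ∈ Ioo (-ε) ε, ContDiffAt ℝ (j + 1 : ℕ∞) g (β t).1 := fun t ht ↦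
    hgat _ (hrO (hαt t ht).1.1)
  have hβℓ : ∀ t ∈ Ioo (-ε) ε, ℓ ((g (β t).1).inverse (β t).2) ≠ 0 := fun t ht ↦ by
    have : (1 : ℝ) / 2 < ℓ ((g (β t).1).inverse (β t).2) := (hαt t ht).1.2.1.1
    exact (by linarith : (0 : ℝ) < ℓ ((g (β t).1).inverse (β t).2)).ne'
  have hβnull : ∀ t ∈ Ioo (-ε) ε, (β t).2 ((g (β t).1).inverse (β t).2) = 0 := fun t ht ↦ by
    rw [nullField_solution_null h.symm hβd
      (fun t ht ↦ (hβg t ht).of_le (by exact_mod_cast le_add_self)) hinvβ ht, hβ0]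
    obtain ⟨q, hq⟩ := (hball y hyr).1
    simp only
    rw [← hq]
    simp only [ContinuousLinearMap.inverse_equiv, ContinuousLinearEquiv.coe_coe,
      ContinuousLinearEquiv.symm_apply_apply]
    rw [← ContinuousLinearEquiv.coe_coe, hq, hnull]
  have hreg := nullField_solution_contDiffOn hβd hβg hinvβ hβℓ
  obtain ⟨u, hu0, hu⟩ := exists_monotone_function (B := Metric.ball x₀ r) (Q := g x₀) h.symm hβd
    hK hc hball hgK' (h.symm x₀) (hball x₀ hx₀r).2 (hQK.trans (le_max_left _ _))
    (fun t ht ↦ ⟨(hαt t ht).1.1, (hαt t ht).1.2.1.1.le, (hαt t ht).1.2.1.2.le,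
      (hαt t ht).1.2.2.le, hβnull t ht⟩)
  have hu' : ∀ x ∈ Metric.ball x₀ r ∩ {x | |ℓ x - ℓ x₀| < θ / 2},
      ∃ u' : E →L[ℝ] ℝ, HasFDerivAt u u' x ∧ ∀ v, 0 < ℓ v → g x v v < 0 → u' v < 0 := by
    rintro x ⟨hxr, hxℓ⟩
    have hlt : |ℓ x - ℓ (β 0).1| < θ := by
      rw [hβ0]
      have : |ℓ x - ℓ y| ≤ |ℓ x - ℓ x₀| + |ℓ y - ℓ x₀| := by
        rw [abs_sub_comm (ℓ y)]; exact abs_sub_le _ _ _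
      have : |ℓ x - ℓ x₀| < θ / 2 := hxℓ
      simp only
      linarith
    refine hu x hxr (hlt.trans_le (min_le_left _ _)) ?_
    rw [← hC]
    have : |ℓ x - ℓ (β 0).1| ≤ 1 / C := (hlt.trans_le (min_le_right _ _)).le
    rwa [le_div_iff₀ hC0] at this
  have h0 : (0 : ℝ) ∈ Ioo (-ε) ε := ⟨by linarith, hε⟩
  have hseg : ∀ t ∈ Ioo (-ε) ε, (β t).1 ∈ O ∧
      ∃ v, HasDerivAt (fun t ↦ (β t).1) v t ∧ g (β t).1 v v = 0 ∧ ℓ v = 1 := by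
    intro t ht
    refine ⟨hrO (hαt t ht).1.1, _, hasDerivAt_fst (hβd t ht), ?_, ?_⟩
    · have h1 := apply_inverse (hinvβ t ht) (β t).2
      have h2 := hβnull t ht
      simp only [nullField, map_smul, smul_apply, h1, h2, smul_zero]
    · simp [nullField, hβℓ t ht]
  have hu0' : ∀ t ∈ Ioo (-ε) ε, u (β t).1 = 0 := hu0
  refine ⟨fun hs0 ↦ ?_, fun hs0 ↦ ?_⟩
  · have hsub : Icc 0 s ⊆ Ioo (-ε) ε := fun t ht ↦ ⟨by linarith [ht.1], by linarith [ht.2, hs.2]⟩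
    refine ⟨fun t ↦ (β t).1, 0, s, hs0, by simp [hβ0], rfl, hreg.mono hsub,
      fun t ht ↦ hseg t (hsub ht), u, ?_, hu'⟩
    have e1 := hu0' 0 h0
    have e2 := hu0' s hs
    rw [hβ0] at e1
    exact e1.trans e2.symm
  · have hsub : Icc s 0 ⊆ Ioo (-ε) ε := fun t ht ↦ ⟨by linarith [ht.1, hs.1], by linarith [ht.2]⟩
    refine ⟨fun t ↦ (β t).1, s, 0, hs0, rfl, by simp [hβ0], hreg.mono hsub,
      fun t ht ↦ hseg t (hsub ht), u, ?_, hu'⟩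
    have e1 := hu0' 0 h0
    have e2 := hu0' s hs
    rw [hβ0] at e1
    exact e2.trans e1.symm

end

end Lorentz

/-! ### Null frames and chains of null segments -/

namespace Lorentz

section

variable {E : Type*} [NormedAddCommGroup E] [NormedSpace ℝ E]
  {g : E → E →L[ℝ] E →L[ℝ] ℝ} {O : Set E} {x₀ : E} {ℓ : E →L[ℝ] ℝ} {e : E}

/-- The timelike vector `e` is a positive combination of spanning null vectors, with coefficients
that depend linearly on the vector. -/
theorem IsLocalMetric.exists_null_frame [FiniteDimensional ℝ E] {k : ℕ∞}
    (h : IsLocalMetric k g O x₀ ℓ e) (hdim : 2 ≤ Module.finrank ℝ E) :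
    ∃ L : List (E × (E →L[ℝ] ℝ)), (∀ p ∈ L, g x₀ p.1 p.1 = 0 ∧ ℓ p.1 = 1 ∧ 0 < p.2 e) ∧
      ∀ y, (L.map fun p ↦ p.2 y • p.1).sum = y := by
  set d := Module.finrank ℝ (LinearMap.ker (ℓ : E →ₗ[ℝ] ℝ)) with hd
  set b : Module.Basis (Fin d) ℝ (LinearMap.ker (ℓ : E →ₗ[ℝ] ℝ)) := Module.finBasis ℝ _
  -- Dimension at least two enters here: without a spacelike direction there would be no vectors in
  -- the frame.
  have hd0 : 0 < d := by
    have h1 := LinearMap.finrank_range_add_finrank_ker (ℓ : E →ₗ[ℝ] ℝ)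
    have h2 : Module.finrank ℝ (LinearMap.range (ℓ : E →ₗ[ℝ] ℝ)) ≤ 1 :=
      (Submodule.finrank_le _).trans_eq (Module.finrank_self ℝ)
    omega
  have hbℓ : ∀ j, ℓ (b j : E) = 0 := fun j ↦ (b j).2
  have hbpos : ∀ j, 0 < g x₀ (b j) (b j) := fun j ↦
    h.pos _ (hbℓ j) (by simpa using b.ne_zero j)
  set c : Fin d → ℝ := fun j ↦ √(-g x₀ e e / g x₀ (b j) (b j)) with hc
  have hc0 : ∀ j, 0 < c j := fun j ↦ Real.sqrt_pos.2 (div_pos (by linarith [h.neg]) (hbpos j))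
  have hc2 : ∀ j, c j * c j * g x₀ (b j) (b j) = -g x₀ e e := fun j ↦ by
    rw [Real.mul_self_sqrt (div_pos (by linarith [h.neg]) (hbpos j)).le,
      div_mul_cancel₀ _ (hbpos j).ne']
  set P : E →ₗ[ℝ] LinearMap.ker (ℓ : E →ₗ[ℝ] ℝ) :=
    LinearMap.codRestrict _ (LinearMap.id - (ℓ : E →ₗ[ℝ] ℝ).smulRight e)
      (fun v ↦ by simp [h.apply_eq_one]) with hP
  have hPe : P e = 0 := by
    apply Subtype.ext
    have : (P e : E) = e - ℓ e • e := rfl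
    simp [this, h.apply_eq_one]
  set a : Fin d → E →L[ℝ] ℝ := fun j ↦ LinearMap.toContinuousLinearMap (b.coord j ∘ₗ P) with ha
  have haj : ∀ j y, a j y = b.repr (P y) j := fun j y ↦ rfl
  set sg : Bool → ℝ := fun s ↦ if s then 1 else -1 with hsg
  have hsg2 : ∀ s, sg s * sg s = 1 := by intro s; cases s <;> simp [hsg]
  -- The frame consists of the `2 d` null vectors `e ± c_j b_j`. It is redundant on purpose: the two
  -- signs let the coefficient forms reproduce every vector while each takes the value `1 / (2 d)`
  -- on `e`.
  refine ⟨(Finset.univ : Finset (Fin d × Bool)).toList.map fun i ↦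
    (e + (sg i.2 * c i.1) • (b i.1 : E),
      (2 * d : ℝ)⁻¹ • ℓ + (sg i.2 * (2 * c i.1)⁻¹) • a i.1), ?_, fun y ↦ ?_⟩
  · intro p hp
    obtain ⟨⟨j, s⟩, -, rfl⟩ := List.mem_map.1 hp
    refine ⟨?_, ?_, ?_⟩
    · have h1 := h.orthogonal _ (hbℓ j)
      simp only [map_add, map_smul, add_apply, smul_apply, smul_eq_mul]
      have h2 := h.symm x₀ e (b j)
      have h3 := hc2 j
      linear_combination 2 * (sg s * c j) * h1 - (sg s * c j) * h2 + h3 + c j * c j * g x₀ (b j) (b j) * hsg2 s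
    · simp [h.apply_eq_one, hbℓ]
    · simp only [add_apply, smul_apply, smul_eq_mul, haj, hPe, h.apply_eq_one, map_zero,
        Finsupp.coe_zero, Pi.zero_apply, mul_zero, add_zero, mul_one]
      positivity
  · rw [List.map_map, Finset.sum_map_toList, Fintype.sum_prod_type]
    have h1 : ∀ j : Fin d, ∑ s : Bool, ((2 * d : ℝ)⁻¹ • ℓ + (sg s * (2 * c j)⁻¹) • a j) y •
        (e + (sg s * c j) • (b j : E)) = (ℓ y / d) • e + (b.repr (P y) j) • (b j : E) := by
      intro j
      have := (hc0 j).ne'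
      rw [Fintype.sum_bool]
      simp only [hsg, if_true, add_apply, smul_apply, smul_eq_mul, haj, Bool.false_eq_true,
        if_false]
      match_scalars <;> field_simp <;> ring
    simp only [Function.comp_def, h1, Finset.sum_add_distrib, Finset.sum_const, Finset.card_univ,
      Fintype.card_fin]
    have h2 : ∑ j, (b.repr (P y) j) • (b j : E) = P y := by
      have := congrArg (Subtype.val) (b.sum_repr (P y))
      rwa [Submodule.coe_sum] at this
    have h3 : (P y : E) = y - ℓ y • e := rfl
    rw [h2, h3, ← Nat.cast_smul_eq_nsmul ℝ, smul_smul, mul_div_cancel₀ _ (by positivity)]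
    abel

theorem NullSegment.mono {k : ℕ∞} {U U' : Set E} {y y' : E} (hU : U' ⊆ U)
    (h : NullSegment k g ℓ O U y y') : NullSegment k g ℓ O U' y y' := by
  obtain ⟨σ, a, b, hab, ha, hb, hσ, hσ', u, hu, hu'⟩ := h
  exact ⟨σ, a, b, hab, ha, hb, hσ, hσ', u, hu, fun x hx ↦ hu' x (hU hx)⟩

/-- Composing null flows. -/
theorem IsLocalMetric.exists_null_chain_map [FiniteDimensional ℝ E] {k : ℕ∞} (hk : 2 ≤ k)
    (h : IsLocalMetric k g O x₀ ℓ e) (L : List (E × (E →L[ℝ] ℝ)))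
    (hL : ∀ p ∈ L, g x₀ p.1 p.1 = 0 ∧ ℓ p.1 = 1) :
    ∃ Ψ : E → E, Ψ 0 = x₀ ∧
      HasStrictFDerivAt Ψ (L.map fun p ↦ p.2.smulRight p.1).sum 0 ∧
      ∃ U ∈ 𝓝 x₀, ∀ V ∈ 𝓝 x₀, ∀ᶠ y in 𝓝 (0 : E),
        ((∀ p ∈ L, 0 < p.2 y) → Relation.ReflTransGen
          (fun z z' ↦ NullSegment k g ℓ O U z z' ∧ z ∈ V ∧ z' ∈ V) x₀ (Ψ y)) ∧
        ((∀ p ∈ L, p.2 y < 0) → Relation.ReflTransGen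
          (fun z z' ↦ NullSegment k g ℓ O U z z' ∧ z ∈ V ∧ z' ∈ V) (Ψ y) x₀) := by
  induction L with
  | nil =>
    refine ⟨fun _ ↦ x₀, rfl, by simpa using hasStrictFDerivAt_const x₀ (0 : E), univ, univ_mem,
      fun V _ ↦ .of_forall fun y ↦ ⟨fun _ ↦ .refl, fun _ ↦ .refl⟩⟩
  | cons p L ih =>
    obtain ⟨Ψ, hΨ0, hΨ, U, hU, hchain⟩ := ih fun q hq ↦ hL q (List.mem_cons_of_mem _ hq)
    obtain ⟨hn, hℓn⟩ := hL p List.mem_cons_self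
    obtain ⟨φ, hφ0, hφ, U', hU', hseg⟩ := h.exists_null_flow hk hn hℓn
    have hin : HasStrictFDerivAt (fun y ↦ (p.2 y, Ψ y))
        (p.2.prod (L.map fun p ↦ p.2.smulRight p.1).sum) 0 :=
      p.2.hasStrictFDerivAt.prodMk hΨ
    have hin0 : (p.2 0, Ψ 0) = (0, x₀) := by simp [hΨ0]
    have hφ' : HasStrictFDerivAt φ (ContinuousLinearMap.snd ℝ ℝ E +
        (ContinuousLinearMap.fst ℝ ℝ E).smulRight p.1) (p.2 0, Ψ 0) := by rwa [hin0]
    have hΨ' : HasStrictFDerivAt (fun y ↦ φ (p.2 y, Ψ y)) _ 0 :=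
      HasStrictFDerivAt.comp (f := fun y ↦ (p.2 y, Ψ y)) 0 hφ' hin
    have hΨ'0 : φ (p.2 0, Ψ 0) = x₀ := by rw [hin0, hφ0]
    -- Each new flow starts where the previous ones end and runs for the signed time `p.2 y`. `U` is
    -- fixed before `V`, since strong causality will produce `V` from `U`.
    refine ⟨fun y ↦ φ (p.2 y, Ψ y), hΨ'0, hΨ'.congr_fderiv ?_, U ∩ U', inter_mem hU hU', ?_⟩
    · ext v
      simp [add_comm]
    · intro V hV
      have ev1 : ∀ᶠ y in 𝓝 (0 : E), Ψ y ∈ V :=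
        hΨ.continuousAt.eventually (p := fun z ↦ z ∈ V) (by rw [hΨ0]; exact hV)
      have ev2 : ∀ᶠ y in 𝓝 (0 : E), φ (p.2 y, Ψ y) ∈ V :=
        hΨ'.continuousAt.eventually (p := fun z ↦ z ∈ V) (by beta_reduce; rw [hΨ'0]; exact hV)
      have ev3 := hin.continuousAt.eventually (p := fun q : ℝ × E ↦
        (0 < q.1 → NullSegment k g ℓ O U' q.2 (φ q)) ∧
        (q.1 < 0 → NullSegment k g ℓ O U' (φ q) q.2)) (by beta_reduce; rw [hin0]; exact hseg)
      filter_upwards [hchain V hV, ev1, ev2, ev3] with y h1 h2 h3 h4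
      refine ⟨fun hy ↦ ?_, fun hy ↦ ?_⟩
      · refine .tail (Relation.ReflTransGen.mono ?_ _ _
          (h1.1 fun q hq ↦ hy q (List.mem_cons_of_mem _ hq))) ⟨(h4.1 (hy p List.mem_cons_self)).mono inter_subset_right, h2, h3⟩
        exact fun z z' hz ↦ ⟨hz.1.mono inter_subset_left, hz.2⟩
      · refine .head ⟨(h4.2 (hy p List.mem_cons_self)).mono inter_subset_right, h3, h2⟩
          (Relation.ReflTransGen.mono ?_ _ _ (h1.2 fun q hq ↦ hy q (List.mem_cons_of_mem _ hq)))
        exact fun z z' hz ↦ ⟨hz.1.mono inter_subset_left, hz.2⟩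

/-- The sign of a function near a zero with positive derivative. -/
theorem eventually_sign_of_hasDerivWithinAt {f : ℝ → ℝ} {f' t₀ : ℝ} {S : Set ℝ}
    (hf : HasDerivWithinAt f f' S t₀) (hf' : 0 < f') (h0 : f t₀ = 0) :
    ∀ᶠ t in 𝓝[S] t₀, (t₀ < t → 0 < f t) ∧ (t < t₀ → f t < 0) := by
  have h1 := (hasDerivWithinAt_iff_tendsto_slope.1 hf).eventually (lt_mem_nhds hf')
  rw [eventually_nhdsWithin_iff] at h1 ⊢
  filter_upwards [h1] with t ht htS
  have key : t ≠ t₀ → 0 < (t - t₀)⁻¹ * f t := fun hne ↦ by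
    have := ht ⟨htS, hne⟩
    rwa [slope_def_field, h0, sub_zero, div_eq_inv_mul] at this
  refine ⟨fun hlt ↦ ?_, fun hlt ↦ ?_⟩
  · exact (mul_pos_iff_of_pos_left (inv_pos.2 (sub_pos.2 hlt))).1 (key hlt.ne')
  · have h2 := key hlt.ne
    have h3 : (t - t₀)⁻¹ < 0 := inv_lt_zero.2 (sub_neg.2 hlt)
    by_contra hcon
    push Not at hcon
    linarith [mul_nonpos_of_nonpos_of_nonneg h3.le hcon]

/-- Points of a curve with tangent `e` are joined to the base point by a chain of null segments. -/
theorem IsLocalMetric.exists_null_chain [FiniteDimensional ℝ E] {k : ℕ∞} (hk : 2 ≤ k)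
    (h : IsLocalMetric k g O x₀ ℓ e) (hdim : 2 ≤ Module.finrank ℝ E) {γ : ℝ → E} {S : Set ℝ}
    {t₀ : ℝ} (hγ : HasDerivWithinAt γ e S t₀) (hγ0 : γ t₀ = x₀) :
    ∃ U ∈ 𝓝 x₀, ∀ V ∈ 𝓝 x₀, ∀ᶠ t in 𝓝[S] t₀,
      (t₀ < t → Relation.ReflTransGen
        (fun z z' ↦ NullSegment k g ℓ O U z z' ∧ z ∈ V ∧ z' ∈ V) x₀ (γ t)) ∧
      (t < t₀ → Relation.ReflTransGen
        (fun z z' ↦ NullSegment k g ℓ O U z z' ∧ z ∈ V ∧ z' ∈ V) (γ t) x₀) := by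
  obtain ⟨L, hL, hsum⟩ := h.exists_null_frame hdim
  obtain ⟨Ψ, hΨ0, hΨ, U, hU, hchain⟩ :=
    h.exists_null_chain_map hk L fun p hp ↦ ⟨(hL p hp).1, (hL p hp).2.1⟩
  refine ⟨U, hU, fun V hV ↦ ?_⟩
  have hid : (L.map fun p ↦ p.2.smulRight p.1).sum = ContinuousLinearMap.id ℝ E := by
    ext y
    conv_rhs => rw [ContinuousLinearMap.id_apply, ← hsum y]
    clear hsum hL hΨ hchain
    induction L with
    | nil => simp
    | cons p L ih => simp [ih]
  rw [hid] at hΨ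
  have hΨ' : HasStrictFDerivAt Ψ ((ContinuousLinearEquiv.refl ℝ E : E ≃L[ℝ] E) : E →L[ℝ] E) 0 :=
    hΨ
  set inv := hΨ'.localInverse with hinv
  have hinv0 : inv x₀ = 0 := by rw [← hΨ0]; exact hΨ'.localInverse_apply_image
  have hinvd : HasStrictFDerivAt inv (ContinuousLinearMap.id ℝ E) (γ t₀) := by
    rw [hγ0, ← hΨ0]
    exact hΨ'.to_localInverse
  -- The pulled-back curve again has tangent `e`, on which all coefficient forms are positive; hence
  -- all flow times have the sign of `t - t₀`.
  have hy : HasDerivWithinAt (fun t ↦ inv (γ t)) e S t₀ :=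
    hinvd.hasFDerivAt.comp_hasDerivWithinAt t₀ hγ
  have hy0 : inv (γ t₀) = 0 := by rw [hγ0, hinv0]
  have hright : ∀ᶠ t in 𝓝[S] t₀, Ψ (inv (γ t)) = γ t := by
    have := hΨ'.eventually_right_inverse
    rw [hΨ0, ← hγ0] at this
    exact hγ.continuousWithinAt.eventually this
  have hev : ∀ᶠ t in 𝓝[S] t₀, _ := hy.continuousWithinAt.eventually
    (p := fun y ↦ ((∀ p ∈ L, 0 < p.2 y) → Relation.ReflTransGen
          (fun z z' ↦ NullSegment k g ℓ O U z z' ∧ z ∈ V ∧ z' ∈ V) x₀ (Ψ y)) ∧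
        ((∀ p ∈ L, p.2 y < 0) → Relation.ReflTransGen
          (fun z z' ↦ NullSegment k g ℓ O U z z' ∧ z ∈ V ∧ z' ∈ V) (Ψ y) x₀))
    (by beta_reduce; rw [hy0]; exact hchain V hV)
  have hsign : ∀ᶠ t in 𝓝[S] t₀, ∀ p ∈ L,
      (t₀ < t → 0 < p.2 (inv (γ t))) ∧ (t < t₀ → p.2 (inv (γ t)) < 0) := by
    have hfin : {p | p ∈ L}.Finite := L.finite_toSet
    refine (eventually_all_finite hfin).2 fun p hp ↦ ?_
    exact eventually_sign_of_hasDerivWithinAt (p.2.hasFDerivAt.comp_hasDerivWithinAt t₀ hy)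
      (hL p hp).2.2 (by simp [hy0])
  filter_upwards [hright, hev, hsign] with t h1 h2 h3
  rw [h1] at h2
  exact ⟨fun ht ↦ h2.1 fun p hp ↦ (h3 p hp).1 ht, fun ht ↦ h2.2 fun p hp ↦ (h3 p hp).2 ht⟩

end

end Lorentz

/-! ### The metric and the time-orientation in a chart -/

namespace Lorentz

section

variable {k : ℕ∞} {E : Type*} [NormedAddCommGroup E] [NormedSpace ℝ E]
  {M : Type*} [TopologicalSpace M] [ChartedSpace E M] [IsManifold 𝓘(ℝ, E) 1 M]

/-- The tangent vector at `q` with given coordinates in the chart at `p₀`. -/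
noncomputable def ofCoord (p₀ q : M) : E →L[ℝ] TangentSpace 𝓘(ℝ, E) q :=
  (trivializationAt E (TangentSpace 𝓘(ℝ, E)) p₀).symmL ℝ q

/-- The coordinates of a tangent vector at `q` in the chart at `p₀`. -/
noncomputable def toCoord (p₀ q : M) : TangentSpace 𝓘(ℝ, E) q →L[ℝ] E :=
  (trivializationAt E (TangentSpace 𝓘(ℝ, E)) p₀).continuousLinearMapAt ℝ q

theorem mem_baseSet_of_mem_source {p₀ q : M} (hq : q ∈ (extChartAt 𝓘(ℝ, E) p₀).source) :
    q ∈ (trivializationAt E (TangentSpace 𝓘(ℝ, E)) p₀).baseSet := by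
  simpa using hq

theorem toCoord_ofCoord {p₀ q : M} (hq : q ∈ (extChartAt 𝓘(ℝ, E) p₀).source) (v : E) :
    toCoord p₀ q (ofCoord p₀ q v) = v :=
  (trivializationAt E (TangentSpace 𝓘(ℝ, E)) p₀).continuousLinearMapAt_symmL
    (mem_baseSet_of_mem_source hq) v

theorem ofCoord_toCoord {p₀ q : M} (hq : q ∈ (extChartAt 𝓘(ℝ, E) p₀).source)
    (v : TangentSpace 𝓘(ℝ, E) q) : ofCoord p₀ q (toCoord p₀ q v) = v :=
  (trivializationAt E (TangentSpace 𝓘(ℝ, E)) p₀).symmL_continuousLinearMapAt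
    (mem_baseSet_of_mem_source hq) v

/-- The metric in the chart at `p₀`. -/
noncomputable def chartMetric [FiniteDimensional ℝ E] (g : LorentzianMetric k E M) (p₀ : M) (x : E) :
    E →L[ℝ] E →L[ℝ] ℝ :=
  LinearMap.toContinuousLinearMap
    ((LinearMap.toContinuousLinearMap (𝕜 := ℝ) (E := E) (F' := ℝ)).toLinearMap ∘ₗ
      LinearMap.mk₂ ℝ (fun v w ↦ g.val ((extChartAt 𝓘(ℝ, E) p₀).symm x)
        (ofCoord p₀ _ v) (ofCoord p₀ _ w))
        (fun a b c ↦ by rw [(ofCoord p₀ _).map_add, map_add, add_apply])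
        (fun a b c ↦ by rw [(ofCoord p₀ _).map_smul, map_smul, smul_apply])
        (fun a b c ↦ by rw [(ofCoord p₀ _).map_add, map_add])
        (fun a b c ↦ by rw [(ofCoord p₀ _).map_smul, map_smul]))

theorem chartMetric_apply [FiniteDimensional ℝ E] (g : LorentzianMetric k E M) (p₀ : M) (x v w : E) :
    chartMetric g p₀ x v w = g.val ((extChartAt 𝓘(ℝ, E) p₀).symm x)
      (ofCoord p₀ _ v) (ofCoord p₀ _ w) := rfl

theorem chartMetric_extChartAt [FiniteDimensional ℝ E] (g : LorentzianMetric k E M) {p₀ q : M}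
    (hq : q ∈ (extChartAt 𝓘(ℝ, E) p₀).source) (v w : E) :
    chartMetric g p₀ (extChartAt 𝓘(ℝ, E) p₀ q) v w =
      g.val q (ofCoord p₀ q v) (ofCoord p₀ q w) := by
  rw [chartMetric_apply, (extChartAt 𝓘(ℝ, E) p₀).left_inv hq]

theorem chartMetric_toCoord [FiniteDimensional ℝ E] (g : LorentzianMetric k E M) {p₀ q : M}
    (hq : q ∈ (extChartAt 𝓘(ℝ, E) p₀).source) (v w : TangentSpace 𝓘(ℝ, E) q) :
    chartMetric g p₀ (extChartAt 𝓘(ℝ, E) p₀ q) (toCoord p₀ q v) (toCoord p₀ q w) =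
      g.val q v w := by
  rw [chartMetric_extChartAt g hq, ofCoord_toCoord hq, ofCoord_toCoord hq]

/-- In finite dimension it suffices to test on constant coordinate vectors; these are `C^k` sections
of the tangent bundle because `M` is of class `C^(k+1)`. -/
theorem contDiffOn_chartMetric [FiniteDimensional ℝ E] [IsManifold 𝓘(ℝ, E) ((k + 1 : ℕ∞) : WithTop ℕ∞) M]
    (g : LorentzianMetric k E M) (p₀ : M) :
    ContDiffOn ℝ k (chartMetric g p₀) (extChartAt 𝓘(ℝ, E) p₀).target := by
  have : IsManifold 𝓘(ℝ, E) ((k : WithTop ℕ∞) + 1) M :=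
    inferInstanceAs (IsManifold 𝓘(ℝ, E) ((k + 1 : ℕ∞) : WithTop ℕ∞) M)
  have : IsManifold 𝓘(ℝ, E) k M := IsManifold.of_le (n := ((k : WithTop ℕ∞) + 1)) le_self_add
  have : ContMDiffVectorBundle k E (TangentSpace 𝓘(ℝ, E) : M → Type _) 𝓘(ℝ, E) :=
    TangentBundle.contMDiffVectorBundle
  rw [contDiffOn_clm_apply]
  intro v
  rw [contDiffOn_clm_apply]
  intro w
  set e := trivializationAt E (TangentSpace 𝓘(ℝ, E)) p₀ with he
  have hsec : ∀ v : E, ContMDiffOn 𝓘(ℝ, E) 𝓘(ℝ, E).tangent k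
      (fun q ↦ TotalSpace.mk' E (E := fun p : M ↦ TangentSpace 𝓘(ℝ, E) p) q (ofCoord p₀ q v))
      (extChartAt 𝓘(ℝ, E) p₀).source := by
    intro v
    rw [e.contMDiffOn_iff (fun q hq ↦ e.mem_source.2 (mem_baseSet_of_mem_source hq))]
    refine ⟨contMDiffOn_id, (contMDiffOn_const (c := v)).congr fun q hq ↦ ?_⟩
    have h1 := toCoord_ofCoord hq v
    rw [toCoord, Trivialization.continuousLinearMapAt_apply,
      Trivialization.coe_linearMapAt_of_mem _ (mem_baseSet_of_mem_source hq)] at h1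
    exact h1
  have hfun : ContMDiffOn 𝓘(ℝ, E) 𝓘(ℝ, ℝ) k
      (fun q ↦ g.val q (ofCoord p₀ q v) (ofCoord p₀ q w)) (extChartAt 𝓘(ℝ, E) p₀).source := by
    intro q hq
    have : ContMDiffWithinAt 𝓘(ℝ, E) (𝓘(ℝ, E).prod 𝓘(ℝ, ℝ)) k
        (fun q ↦ TotalSpace.mk' ℝ (E := Bundle.Trivial M ℝ) q
          (g.val q (ofCoord p₀ q v) (ofCoord p₀ q w))) (extChartAt 𝓘(ℝ, E) p₀).source q := by
      apply ContMDiffWithinAt.clm_bundle_apply₂ (F₁ := E) (F₂ := E)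
      · exact g.contMDiff.contMDiffAt.contMDiffWithinAt
      · exact hsec v q hq
      · exact hsec w q hq
    simp only [contMDiffWithinAt_totalSpace] at this
    exact this.2
  rw [← contMDiffOn_iff_contDiffOn]
  exact hfun.comp (contMDiffOn_extChartAt_symm p₀)
    (fun x hx ↦ (extChartAt 𝓘(ℝ, E) p₀).map_target hx)

/-- A Lorentzian scalar product is positive definite on the orthogonal complement of any timelike
vector. -/
theorem LorentzianMetric.pos_of_orthogonal (g : LorentzianMetric k E M) {q : M}
    {e v : TangentSpace 𝓘(ℝ, E) q} (he : g.IsTimelike e) (hv : g.val q e v = 0) (hv0 : v ≠ 0) :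
    0 < g.val q v v := by
  obtain ⟨f, hf, hpos⟩ := g.signature q
  have he' : g.val q e e < 0 := he
  have hfe : g.val q f e ≠ 0 := fun h0 ↦ by
    have he0 : e ≠ 0 := by rintro rfl; simp at he'
    linarith [hpos e h0 he0]
  by_contra hcon
  push Not at hcon
  -- Subtracting `c • e` moves `v` into the complement of `f`, where the form is positive definite.
  -- Its value there is `g(v,v) + c² g(e,e) ≤ 0`, so `v = c • e`, and orthogonality to `e` gives `c
  -- = 0`.
  set c := g.val q f v / g.val q f e with hc
  have h1 : g.val q f (v - c • e) = 0 := by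
    simp only [map_sub, map_smul, smul_eq_mul, hc]
    field_simp
    ring
  have h2 : g.val q (v - c • e) (v - c • e) = g.val q v v + c * c * g.val q e e := by
    simp only [map_sub, map_smul, sub_apply, smul_apply, smul_eq_mul, hv, g.symm q v e]
    ring
  have h3 : v - c • e = 0 := by
    by_contra h0
    have := hpos _ h1 h0
    nlinarith [mul_self_nonneg c]
  have h4 : v = c • e := sub_eq_zero.1 h3
  have h5 : c * g.val q e e = 0 := by rw [h4] at hv; simpa using hv
  have h6 : c = 0 := (mul_eq_zero.1 h5).resolve_right he'.ne
  rw [h6, zero_smul] at h4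
  exact hv0 h4

/-- If the form `ℓ` has a spacelike kernel, a causal cone that contains a vector on which `ℓ` is
positive consists of all causal vectors on which `ℓ` is positive. -/
theorem LorentzianMetric.causalCone_eq (g : LorentzianMetric k E M) {q : M}
    {ℓ : TangentSpace 𝓘(ℝ, E) q →ₗ[ℝ] ℝ} (hℓ : ∀ v, ℓ v = 0 → v ≠ 0 → 0 < g.val q v v)
    {C : Set (TangentSpace 𝓘(ℝ, E) q)} (hC : g.IsCausalCone q C)
    {X : TangentSpace 𝓘(ℝ, E) q} (hX : X ∈ C) (hXℓ : 0 < ℓ X) :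
    C = {v | g.IsCausal v ∧ 0 < ℓ v} := by
  obtain ⟨w, hw, rfl⟩ := hC
  have hne : ∀ v : TangentSpace 𝓘(ℝ, E) q, g.IsCausal v → ℓ v ≠ 0 := fun v hv h0 ↦
    (hℓ v h0 hv.2).not_ge hv.1
  -- The vector `ℓ w • v - ℓ v • w` lies in the spacelike kernel of `ℓ`; expanding its nonnegative
  -- square gives the sign of `g(w, v)`.
  have key : ∀ v w : TangentSpace 𝓘(ℝ, E) q, g.IsCausal v → g.IsTimelike w → 0 < ℓ v → 0 < ℓ w →
      g.val q w v < 0 := by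
    intro v w hv hw hv0 hw0
    have h0 : 0 ≤ g.val q (ℓ w • v - ℓ v • w) (ℓ w • v - ℓ v • w) := by
      by_cases h : ℓ w • v - ℓ v • w = 0
      · simp [h]
      · exact (hℓ _ (by simp [mul_comm]) h).le
    simp only [map_sub, map_smul, sub_apply, smul_apply, smul_eq_mul] at h0
    rw [g.symm q v w] at h0
    have h1 : ℓ w * (ℓ w * g.val q v v) ≤ 0 :=
      mul_nonpos_of_nonneg_of_nonpos hw0.le (mul_nonpos_of_nonneg_of_nonpos hw0.le hv.1)
    have h2 : ℓ v * (ℓ v * g.val q w w) < 0 :=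
      mul_neg_of_pos_of_neg hv0 (mul_neg_of_pos_of_neg hv0 hw)
    have h3 : ℓ w * ℓ v * g.val q w v < 0 := by linarith
    by_contra hcon
    push Not at hcon
    have : 0 ≤ ℓ w * ℓ v * g.val q w v := by positivity
    linarith
  have hw0 : w ≠ 0 := by rintro rfl; simp [LorentzianMetric.IsTimelike] at hw
  have hwℓ : 0 < ℓ w := by
    rcases lt_trichotomy (ℓ w) 0 with h | h | h
    · have := key X (-w) hX.1 (by simpa [LorentzianMetric.IsTimelike] using hw) hXℓ
        (by simpa using h)
      simp only [map_neg, neg_apply] at this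
      linarith [hX.2]
    · exact absurd h (hne w ⟨le_of_lt hw, hw0⟩)
    · exact h
  ext v
  refine and_congr_right fun hv ↦ ⟨fun h ↦ ?_, fun h ↦ key v w hv hw h hwℓ⟩
  rcases lt_trichotomy (ℓ v) 0 with h' | h' | h'
  · have := key (-v) w ⟨by simpa using hv.1, by simpa using hv.2⟩ hw (by simpa using h') hwℓ
    simp only [map_neg] at this
    linarith
  · exact absurd h' (hne v hv)
  · exact h'

/-- Near a point the future cone is described by any linear form in a chart that has a uniformly
spacelike kernel and is positive on some future vector at that point. -/
theorem TimeOrientation.eventually_future_eq [FiniteDimensional ℝ E] {g : LorentzianMetric k E M} (T : TimeOrientation g)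
    {p₀ : M} {ℓ : E →L[ℝ] ℝ}
    (hℓ : ∀ᶠ x in 𝓝 (extChartAt 𝓘(ℝ, E) p₀ p₀), ∀ v, ℓ v = 0 → v ≠ 0 → 0 < chartMetric g p₀ x v v)
    {v₀ : TangentSpace 𝓘(ℝ, E) p₀} (hv₀ : v₀ ∈ T.future p₀) (hv₀ℓ : 0 < ℓ (toCoord p₀ p₀ v₀)) :
    ∀ᶠ q in 𝓝 p₀, T.future q = {v | g.IsCausal v ∧ 0 < ℓ (toCoord p₀ q v)} := by
  set e := trivializationAt E (TangentSpace 𝓘(ℝ, E)) p₀ with he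
  obtain ⟨U, hU, X, hX, hXf⟩ := T.smooth p₀
  have hsrc : ∀ᶠ q in 𝓝 p₀, q ∈ (extChartAt 𝓘(ℝ, E) p₀).source :=
    extChartAt_source_mem_nhds p₀
  have hℓ' : ∀ᶠ q in 𝓝 p₀, ∀ v, ℓ v = 0 → v ≠ 0 →
      0 < chartMetric g p₀ (extChartAt 𝓘(ℝ, E) p₀ q) v v :=
    (continuousAt_extChartAt p₀).eventually hℓ
  have hpos : ∀ q ∈ (extChartAt 𝓘(ℝ, E) p₀).source, (∀ v, ℓ v = 0 → v ≠ 0 →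
      0 < chartMetric g p₀ (extChartAt 𝓘(ℝ, E) p₀ q) v v) →
      ∀ v : TangentSpace 𝓘(ℝ, E) q, ((ℓ : E →ₗ[ℝ] ℝ) ∘ₗ (toCoord p₀ q).toLinearMap) v = 0 →
        v ≠ 0 → 0 < g.val q v v := by
    intro q hq h v hv hv0
    rw [← chartMetric_toCoord g hq]
    refine h _ hv fun h0 ↦ hv0 ?_
    rw [← ofCoord_toCoord hq v, h0, map_zero]
  have hp₀ := mem_of_mem_nhds hU
  have hsrc₀ : p₀ ∈ (extChartAt 𝓘(ℝ, E) p₀).source := mem_extChartAt_source p₀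
  -- The cone at `p₀` is already determined by `ℓ`, so the local field is positive under `ℓ` there;
  -- continuity then selects the correct cone at nearby points.
  have hX₀ : 0 < ℓ (toCoord p₀ p₀ (X p₀)) := by
    have := g.causalCone_eq (hpos p₀ hsrc₀ hℓ'.self_of_nhds) (T.isCausalCone p₀) hv₀ hv₀ℓ
    have h1 := hXf p₀ hp₀
    rw [this] at h1
    exact h1.2
  have hcont : ContinuousAt (fun q ↦ (e ⟨q, X q⟩).2) p₀ := by
    have h1 : ContinuousAt (fun q ↦ (⟨q, X q⟩ : TangentBundle 𝓘(ℝ, E) M)) p₀ :=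
      (hX.continuousOn.continuousAt hU)
    have h2 : ContinuousAt e (⟨p₀, X p₀⟩ : TangentBundle 𝓘(ℝ, E) M) :=
      e.toOpenPartialHomeomorph.continuousAt
        (e.mem_source.2 (mem_baseSet_of_mem_source hsrc₀))
    exact continuousAt_snd.comp (ContinuousAt.comp (f := fun q ↦
      (⟨q, X q⟩ : TangentBundle 𝓘(ℝ, E) M)) h2 h1)
  have htc : ∀ q ∈ (extChartAt 𝓘(ℝ, E) p₀).source, toCoord p₀ q (X q) = (e ⟨q, X q⟩).2 := by
    intro q hq
    rw [toCoord, Trivialization.continuousLinearMapAt_apply,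
      Trivialization.coe_linearMapAt_of_mem _ (mem_baseSet_of_mem_source hq)]
  have hXpos : ∀ᶠ q in 𝓝 p₀, 0 < ℓ (e ⟨q, X q⟩).2 :=
    (ℓ.continuous.continuousAt.comp hcont).eventually (lt_mem_nhds (by
      rw [Function.comp_apply, ← htc p₀ hsrc₀]; exact hX₀))
  filter_upwards [hsrc, hℓ', hXpos, hU] with q h1 h2 h3 h4
  rw [← htc q h1] at h3
  exact g.causalCone_eq (hpos q h1 h2) (T.isCausalCone q) (hXf q h4) h3

end

end Lorentz

/-! ### From null segments in a chart to horismotic chains on the manifold -/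

namespace Lorentz

section

variable {k : ℕ∞} {E : Type*} [NormedAddCommGroup E] [NormedSpace ℝ E]
  {M : Type*} [TopologicalSpace M] [ChartedSpace E M] [IsManifold 𝓘(ℝ, E) 1 M]

/-- The derivative of a curve read in a chart. -/
theorem hasDerivWithinAt_extChartAt_comp {p₀ : M} {γ : ℝ → M} {S : Set ℝ} {t : ℝ}
    (hγ : MDifferentiableWithinAt 𝓘(ℝ, ℝ) 𝓘(ℝ, E) γ S t)
    (ht : γ t ∈ (extChartAt 𝓘(ℝ, E) p₀).source) :
    HasDerivWithinAt (fun s ↦ extChartAt 𝓘(ℝ, E) p₀ (γ s))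
      (toCoord p₀ (γ t) (mfderivWithin 𝓘(ℝ, ℝ) 𝓘(ℝ, E) γ S t (1 : ℝ))) S t := by
  have hsrc : γ t ∈ (chartAt E p₀).source := by simpa using ht
  have h1 := (mdifferentiableAt_extChartAt (I := 𝓘(ℝ, E)) hsrc).hasMFDerivAt.comp_hasMFDerivWithinAt
    t hγ.hasMFDerivWithinAt
  rw [hasMFDerivWithinAt_iff_hasFDerivWithinAt] at h1
  obtain ⟨L, hL⟩ : ∃ L : ℝ →L[ℝ] E, L = (mfderiv 𝓘(ℝ, E) 𝓘(ℝ, E) (extChartAt 𝓘(ℝ, E) p₀) (γ t)).comp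
    (mfderivWithin 𝓘(ℝ, ℝ) 𝓘(ℝ, E) γ S t) := ⟨_, rfl⟩
  have h2 : HasFDerivWithinAt (fun s ↦ extChartAt 𝓘(ℝ, E) p₀ (γ s)) L S t := by
    rw [hL]
    exact h1
  have h3 := h2.hasDerivWithinAt
  rw [hL] at h3
  rw [toCoord, TangentBundle.continuousLinearMapAt_trivializationAt hsrc]
  exact h3

/-- The derivative of a curve given in a chart. -/
theorem mfderivWithin_extChartAt_symm_comp {p₀ : M} {σ : ℝ → E} {v : E} {S : Set ℝ} {t : ℝ}
    (hσ : HasDerivAt σ v t) (hS : UniqueDiffWithinAt ℝ S t)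
    (ht : σ t ∈ (extChartAt 𝓘(ℝ, E) p₀).target) :
    mfderivWithin 𝓘(ℝ, ℝ) 𝓘(ℝ, E) (fun s ↦ (extChartAt 𝓘(ℝ, E) p₀).symm (σ s)) S t (1 : ℝ) =
      ofCoord p₀ ((extChartAt 𝓘(ℝ, E) p₀).symm (σ t)) v := by
  have hsrc : (extChartAt 𝓘(ℝ, E) p₀).symm (σ t) ∈ (chartAt E p₀).source := by
    simpa using (extChartAt 𝓘(ℝ, E) p₀).map_target ht
  have h1 : HasMFDerivAt 𝓘(ℝ, E) 𝓘(ℝ, E) (extChartAt 𝓘(ℝ, E) p₀).symm (σ t)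
      (mfderivWithin 𝓘(ℝ, E) 𝓘(ℝ, E) (extChartAt 𝓘(ℝ, E) p₀).symm (range 𝓘(ℝ, E)) (σ t)) := by
    have := (mdifferentiableWithinAt_extChartAt_symm ht).hasMFDerivWithinAt
    rw [← hasMFDerivWithinAt_univ]
    rw [ModelWithCorners.range_eq_univ] at this ⊢
    exact this
  have h2 : HasMFDerivWithinAt 𝓘(ℝ, ℝ) 𝓘(ℝ, E) σ S t _ :=
    (hσ.hasFDerivAt.hasMFDerivAt).hasMFDerivWithinAt
  have h3 := (h1.comp_hasMFDerivWithinAt t h2).mfderivWithin hS.uniqueMDiffWithinAt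
  rw [ofCoord, TangentBundle.symmL_trivializationAt hsrc, (extChartAt 𝓘(ℝ, E) p₀).right_inv ht]
  have h4 := congrArg (fun L : ℝ →L[ℝ] E ↦ L 1) h3
  refine h4.trans ?_
  change mfderivWithin 𝓘(ℝ, E) 𝓘(ℝ, E) (extChartAt 𝓘(ℝ, E) p₀).symm (range 𝓘(ℝ, E)) (σ t)
    ((1 : ℝ) • v) = _
  rw [one_smul]
  rfl

theorem Icc_subset_of_partition {a b : ℝ} {n : ℕ} {t : ℕ → ℝ} (h0 : t 0 = a) (hn : t n = b)
    (ht : ∀ i < n, t i < t (i + 1)) {i : ℕ} (hi : i < n) :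
    Icc (t i) (t (i + 1)) ⊆ Icc a b := by
  have h1 : ∀ j, j ≤ n → a ≤ t j := by
    intro j
    induction j with
    | zero => intro _; exact h0.ge
    | succ j ih => intro hj; exact (ih (by omega)).trans (ht j (by omega)).le
  have h2 : ∀ j, j ≤ n → t (n - j) ≤ b := by
    intro j
    induction j with
    | zero => intro _; simpa using hn.le
    | succ j ih =>
      intro hj
      have h3 := ht (n - (j + 1)) (by omega)
      have h4 : n - (j + 1) + 1 = n - j := by omega
      rw [h4] at h3
      exact h3.le.trans (ih (by omega))
  have h3 := h2 (n - (i + 1)) (by omega)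
  rw [Nat.sub_sub_self (by omega)] at h3
  exact fun s hs ↦ ⟨(h1 i hi.le).trans hs.1, hs.2.trans h3⟩

/-- A function that strictly decreases on all pieces of a partition decreases. -/
theorem lt_of_strictAntiOn_partition {f : ℝ → ℝ} {n : ℕ} {t : ℕ → ℝ} (hn : 0 < n)
    (ht : ∀ i < n, t i < t (i + 1)) (hf : ∀ i < n, StrictAntiOn f (Icc (t i) (t (i + 1)))) :
    f (t n) < f (t 0) := by
  have step : ∀ i < n, f (t (i + 1)) < f (t i) := fun i hi ↦
    hf i hi (left_mem_Icc.2 (ht i hi).le) (right_mem_Icc.2 (ht i hi).le) (ht i hi)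
  induction n with
  | zero => omega
  | succ n ih =>
    rcases n.eq_zero_or_pos with rfl | hn'
    · exact step 0 (by omega)
    · exact (step n (by omega)).trans (ih hn' (fun i hi ↦ ht i (by omega))
        (fun i hi ↦ hf i (by omega)) (fun i hi ↦ step i (by omega)))

theorem pos_of_partition {a b : ℝ} (hab : a < b) {n : ℕ} {t : ℕ → ℝ} (h0 : t 0 = a)
    (hn : t n = b) : 0 < n := by
  rcases n.eq_zero_or_pos with rfl | h
  · linarith
  · exact h

variable {g : LorentzianMetric k E M}

theorem TimeOrientation.IsTimelikeCurve.isCausalCurve {T : TimeOrientation g} {γ : ℝ → M} {a b : ℝ}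
    (h : T.IsTimelikeCurve γ a b) : T.IsCausalCurve γ a b := by
  obtain ⟨hab, n, t, h0, hn, ht⟩ := h
  exact ⟨hab, n, t, h0, hn, fun i hi ↦ ⟨(ht i hi).1, (ht i hi).2.1, fun s hs ↦
    ((ht i hi).2.2 s hs).1⟩⟩

/-- Null segments in a chart give horismotically related points. -/
theorem NullSegment.horismos [FiniteDimensional ℝ E]
    [IsManifold 𝓘(ℝ, E) ((k + 1 : ℕ∞) : WithTop ℕ∞) M] {T : TimeOrientation g} {p₀ : M}
    {ℓ : E →L[ℝ] ℝ} {N : Set M} (hN : N ⊆ (extChartAt 𝓘(ℝ, E) p₀).source)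
    (hfut : ∀ q ∈ N, T.future q = {v | g.IsCausal v ∧ 0 < ℓ (toCoord p₀ q v)})
    {O U : Set E} (hO : O ⊆ (extChartAt 𝓘(ℝ, E) p₀).target)
    (hON : ∀ x ∈ O, (extChartAt 𝓘(ℝ, E) p₀).symm x ∈ N) {V : Set M}
    (hV : ∀ (γ : ℝ → M) (a b : ℝ), T.IsCausalCurve γ a b → γ a ∈ V → γ b ∈ V →
      ∀ s ∈ Icc a b, γ s ∈ N ∧ extChartAt 𝓘(ℝ, E) p₀ (γ s) ∈ U)
    {y y' : E} (h : NullSegment k (chartMetric g p₀) ℓ O U y y')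
    (hy : (extChartAt 𝓘(ℝ, E) p₀).symm y ∈ V) (hy' : (extChartAt 𝓘(ℝ, E) p₀).symm y' ∈ V) :
    T.Horismos ((extChartAt 𝓘(ℝ, E) p₀).symm y) ((extChartAt 𝓘(ℝ, E) p₀).symm y') := by
  obtain ⟨σ, a, b, hab, rfl, rfl, hσ, hσ', u, hu, hu'⟩ := h
  refine ⟨Or.inr ⟨fun s ↦ (extChartAt 𝓘(ℝ, E) p₀).symm (σ s), a, b, ⟨hab, 1,
    fun i ↦ if i = 0 then a else b, by simp, by simp, fun i hi ↦ ?_⟩, rfl, rfl⟩, ?_⟩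
  · obtain rfl : i = 0 := by omega
    simp only [if_true, zero_add, one_ne_zero, if_false]
    refine ⟨hab, ?_, fun s hs ↦ ?_⟩
    · exact (contMDiffOn_extChartAt_symm p₀).comp hσ.contMDiffOn fun s hs ↦ hO (hσ' s hs).1
    · obtain ⟨hsO, v, hv, hnull, hℓv⟩ := hσ' s hs
      have hsrc := hN (hON _ hsO)
      rw [mfderivWithin_extChartAt_symm_comp hv (uniqueDiffOn_Icc hab s hs) (hO hsO),
        hfut _ (hON _ hsO)]
      refine ⟨⟨?_, fun h0 ↦ ?_⟩, ?_⟩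
      · rw [chartMetric_apply] at hnull
        exact hnull.le
      · have h1 := toCoord_ofCoord hsrc v
        rw [h0, map_zero] at h1
        simp [← h1] at hℓv
      · rw [toCoord_ofCoord hsrc, hℓv]
        exact one_pos
  -- A timelike curve with these endpoints would be confined to `U`, and `u` would strictly decrease
  -- along it although it agrees at both ends.
  · rintro ⟨γ, c, d, hγ, hγc, hγd⟩
    have hin := hV γ c d hγ.isCausalCurve (by rwa [hγc]) (by rwa [hγd])
    obtain ⟨hcd, n, t, h0, hn, ht⟩ := hγ
    have hanti : ∀ i < n, StrictAntiOn (fun s ↦ u (extChartAt 𝓘(ℝ, E) p₀ (γ s)))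
        (Icc (t i) (t (i + 1))) := by
      intro i hi
      obtain ⟨hlt, hsm, htan⟩ := ht i hi
      have hsub := Icc_subset_of_partition h0 hn (fun i hi ↦ (ht i hi).1) hi
      have hder : ∀ s ∈ Icc (t i) (t (i + 1)), ∃ f' < 0, HasDerivWithinAt
          (fun s ↦ u (extChartAt 𝓘(ℝ, E) p₀ (γ s))) f' (Icc (t i) (t (i + 1))) s := by
        intro s hs
        obtain ⟨hsN, hsU⟩ := hin s (hsub hs)
        obtain ⟨u', hud, hneg⟩ := hu' _ hsU
        have hmd : MDifferentiableWithinAt 𝓘(ℝ, ℝ) 𝓘(ℝ, E) γ (Icc (t i) (t (i + 1))) s :=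
          (hsm s hs).mdifferentiableWithinAt (by simp)
        have h1 := hasDerivWithinAt_extChartAt_comp hmd (hN hsN)
        refine ⟨_, hneg _ ?_ ?_, hud.comp_hasDerivWithinAt s h1⟩
        · have h2 := (htan s hs).1
          rw [hfut _ hsN] at h2
          exact h2.2
        · rw [chartMetric_toCoord g (hN hsN)]
          exact (htan s hs).2
      refine strictAntiOn_of_deriv_neg (convex_Icc _ _) (fun s hs ↦ ?_) fun s hs ↦ ?_
      · obtain ⟨f', -, h1⟩ := hder s hs
        exact h1.continuousWithinAt
      · rw [interior_Icc] at hs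
        obtain ⟨f', h1, h2⟩ := hder s (Ioo_subset_Icc_self hs)
        rw [(h2.hasDerivAt (Icc_mem_nhds hs.1 hs.2)).deriv]
        exact h1
    have hlt := lt_of_strictAntiOn_partition (pos_of_partition hcd h0 hn)
      (fun i hi ↦ (ht i hi).1) hanti
    simp only [h0, hn, hγc, hγd] at hlt
    rw [(extChartAt 𝓘(ℝ, E) p₀).right_inv (hO (hσ' a (left_mem_Icc.2 hab.le)).1),
      (extChartAt 𝓘(ℝ, E) p₀).right_inv (hO (hσ' b (right_mem_Icc.2 hab.le)).1), hu] at hlt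
    exact lt_irrefl _ hlt

/-- In a strongly causal spacetime, nearby points of a timelike curve are joined by horismotic
chains. -/
theorem TimeOrientation.StronglyCausal.eventually_chain [FiniteDimensional ℝ E] (hk : 2 ≤ k)
    (hdim : 2 ≤ Module.finrank ℝ E) [IsManifold 𝓘(ℝ, E) ((k + 1 : ℕ∞) : WithTop ℕ∞) M]
    {T : TimeOrientation g} (hT : T.StronglyCausal) {γ : ℝ → M} {S : Set ℝ} {t₀ : ℝ}
    (hγ : MDifferentiableWithinAt 𝓘(ℝ, ℝ) 𝓘(ℝ, E) γ S t₀)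
    (hfut : mfderivWithin 𝓘(ℝ, ℝ) 𝓘(ℝ, E) γ S t₀ (1 : ℝ) ∈ T.future (γ t₀))
    (htime : g.IsTimelike (p := γ t₀) (mfderivWithin 𝓘(ℝ, ℝ) 𝓘(ℝ, E) γ S t₀ (1 : ℝ))) :
    ∀ᶠ t in 𝓝[S] t₀, (t₀ < t → Relation.ReflTransGen T.Horismos (γ t₀) (γ t)) ∧
      (t < t₀ → Relation.ReflTransGen T.Horismos (γ t) (γ t₀)) := by
  set p₀ := γ t₀ with hp₀
  set φ := extChartAt 𝓘(ℝ, E) p₀ with hφ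
  set v₀ : TangentSpace 𝓘(ℝ, E) p₀ := mfderivWithin 𝓘(ℝ, ℝ) 𝓘(ℝ, E) γ S t₀ (1 : ℝ) with hv₀
  set x₀ := φ p₀ with hx₀
  set G := chartMetric g p₀ with hG
  set e := toCoord p₀ p₀ v₀ with he
  have hsrc : p₀ ∈ φ.source := mem_extChartAt_source p₀
  have hGee : G x₀ e e < 0 := by
    rw [hG, hx₀, hφ, chartMetric_toCoord g hsrc]
    exact htime
  -- The kernel is the orthogonal complement of `e`; dividing by the negative number `G x₀ e e`
  -- makes `ℓ` positive on the future side.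
  set ℓ : E →L[ℝ] ℝ := (G x₀ e e)⁻¹ • G x₀ e with hℓ
  have hℓe : ℓ e = 1 := by
    simp only [hℓ, smul_apply, smul_eq_mul]
    exact inv_mul_cancel₀ hGee.ne
  have horth : ∀ v, ℓ v = 0 → G x₀ e v = 0 := fun v hv ↦ by
    simpa [hℓ, hGee.ne] using hv
  have hlocal : ∀ O ⊆ φ.target, IsOpen O → x₀ ∈ O → IsLocalMetric k G O x₀ ℓ e := by
    intro O hO hOopen hxO
    refine ⟨hOopen, hxO, (contDiffOn_chartMetric g p₀).mono hO, fun x v w ↦ ?_, fun v hv hv0 ↦ ?_,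
      hGee, hℓe, horth⟩
    · rw [hG, chartMetric_apply, chartMetric_apply, g.symm]
    · have h1 := horth v hv
      rw [← toCoord_ofCoord hsrc v, hG, hx₀, hφ, he, chartMetric_toCoord g hsrc] at h1
      rw [hG, hx₀, hφ, chartMetric_extChartAt g hsrc]
      refine g.pos_of_orthogonal htime h1 fun h0 ↦ hv0 ?_
      rw [← toCoord_ofCoord hsrc v, h0, map_zero]
  have htarget : IsOpen φ.target := isOpen_extChartAt_target p₀
  have hxt : x₀ ∈ φ.target := φ.map_source hsrc
  obtain ⟨r, hr, -, -, c, hc, -, hcoer, -, -⟩ :=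
    (hlocal _ subset_rfl htarget hxt).exists_bounds hk
  have hev := T.eventually_future_eq (p₀ := p₀) (ℓ := ℓ) (v₀ := v₀) (by
      filter_upwards [Metric.ball_mem_nhds x₀ hr] with x hx v hv hv0
      have h1 := (hcoer x hx).2 v hv
      have h2 : 0 < ‖v‖ := norm_pos_iff.2 hv0
      exact lt_of_lt_of_le (by positivity) h1) hfut (by rw [← he, hℓe]; exact one_pos)
  set N : Set M := {q | T.future q = {v | g.IsCausal v ∧ 0 < ℓ (toCoord p₀ q v)}} ∩ φ.source
    with hNdef
  have hN : N ∈ 𝓝 p₀ := inter_mem hev (extChartAt_source_mem_nhds p₀)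
  have hsymm : ContinuousAt φ.symm x₀ := continuousAt_extChartAt_symm p₀
  have hsymm0 : φ.symm x₀ = p₀ := extChartAt_to_inv p₀
  have hpre : ∀ W ∈ 𝓝 p₀, φ.symm ⁻¹' W ∈ 𝓝 x₀ := fun W hW ↦
    hsymm.preimage_mem_nhds (by rwa [hsymm0])
  -- The order of choices matters: `ℓ` describes the future cones on `N`, geodesics run in `O`,
  -- which maps into `N`, the monotone functions live on `U`, and `V` comes last, from strong
  -- causality applied to `N ∩ φ ⁻¹' U`.
  set O := interior (φ.symm ⁻¹' N) ∩ φ.target with hOdef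
  have hOm := hlocal O inter_subset_right (isOpen_interior.inter htarget)
    ⟨mem_interior_iff_mem_nhds.2 (hpre N hN), hxt⟩
  obtain ⟨U, hU, hchain⟩ := hOm.exists_null_chain hk hdim
    (hasDerivWithinAt_extChartAt_comp hγ hsrc) rfl
  have hUM : N ∩ φ ⁻¹' U ∈ 𝓝 p₀ :=
    inter_mem hN ((continuousAt_extChartAt p₀).preimage_mem_nhds hU)
  obtain ⟨V, hV, -, hVcausal⟩ := hT p₀ _ hUM
  have hlift : ∀ z z' : E, (NullSegment k G ℓ O U z z' ∧ z ∈ φ.symm ⁻¹' V ∧ z' ∈ φ.symm ⁻¹' V) →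
      T.Horismos (φ.symm z) (φ.symm z') := fun z z' h ↦
    h.1.horismos (N := N) (O := O) (U := U) (V := V) inter_subset_right (fun q hq ↦ hq.1) inter_subset_right
      (fun x hx ↦ show x ∈ φ.symm ⁻¹' N from interior_subset hx.1) hVcausal h.2.1 h.2.2
  have hback : ∀ᶠ t in 𝓝[S] t₀, φ.symm (φ (γ t)) = γ t := by
    filter_upwards [hγ.continuousWithinAt (extChartAt_source_mem_nhds (I := 𝓘(ℝ, E)) p₀)] with t ht
    exact φ.left_inv ht
  filter_upwards [hchain _ (hpre V hV), hback] with t ht htb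
  refine ⟨fun hlt ↦ ?_, fun hlt ↦ ?_⟩
  · have : Relation.ReflTransGen T.Horismos (φ.symm x₀) (φ.symm (φ (γ t))) :=
      (ht.1 hlt).lift φ.symm hlift
    rwa [htb, hsymm0] at this
  · have : Relation.ReflTransGen T.Horismos (φ.symm (φ (γ t))) (φ.symm x₀) :=
      (ht.2 hlt).lift φ.symm hlift
    rwa [htb, hsymm0] at this

end

end Lorentz

/-! ### Piecewise curves, causal relations and the passage from local to global -/

namespace Lorentz

section

variable {k : ℕ∞} {E : Type*} [NormedAddCommGroup E] [NormedSpace ℝ E]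
  {M : Type*} [TopologicalSpace M] [ChartedSpace E M]

/-- `γ` is a `C^r` curve on `[a, b]` all of whose tangent vectors lie in `D`. -/
def IsSmoothPiece (r : ℕ∞) (D : (p : M) → Set (TangentSpace 𝓘(ℝ, E) p))
    (γ : ℝ → M) (a b : ℝ) : Prop :=
  a < b ∧ ContMDiffOn 𝓘(ℝ, ℝ) 𝓘(ℝ, E) r γ (Icc a b) ∧
    ∀ s ∈ Icc a b, mfderivWithin 𝓘(ℝ, ℝ) 𝓘(ℝ, E) γ (Icc a b) s (1 : ℝ) ∈ D (γ s)

variable {r : ℕ∞} {D : (p : M) → Set (TangentSpace 𝓘(ℝ, E) p)}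

/-- Membership in a family of sets of vectors, along an equality of base points. -/
theorem mem_of_eq_base {p q : M} (h : p = q) {v w : E} (hvw : v = w)
    (hw : (show TangentSpace 𝓘(ℝ, E) q from w) ∈ D q) :
    (show TangentSpace 𝓘(ℝ, E) p from v) ∈ D p := by
  subst h hvw
  exact hw

theorem IsSmoothPiece.congr {γ γ' : ℝ → M} {a b : ℝ} (h : IsSmoothPiece r D γ a b)
    (he : EqOn γ' γ (Icc a b)) : IsSmoothPiece r D γ' a b := by
  refine ⟨h.1, h.2.1.congr he, fun s hs ↦ ?_⟩
  have h2 : mfderivWithin 𝓘(ℝ, ℝ) 𝓘(ℝ, E) γ' (Icc a b) s =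
      mfderivWithin 𝓘(ℝ, ℝ) 𝓘(ℝ, E) γ (Icc a b) s := mfderivWithin_congr he (he hs)
  have h3 := congrArg (fun L : ℝ →L[ℝ] E ↦ L 1) h2
  exact mem_of_eq_base (he hs) h3 (h.2.2 s hs)

theorem IsSmoothPiece.comp_add {γ : ℝ → M} {a b : ℝ} (h : IsSmoothPiece r D γ a b) (hr : r ≠ 0)
    (τ : ℝ) : IsSmoothPiece r D (fun s ↦ γ (s + τ)) (a - τ) (b - τ) := by
  have hmaps : MapsTo (fun s : ℝ ↦ s + τ) (Icc (a - τ) (b - τ)) (Icc a b) := fun s hs ↦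
    ⟨by linarith [hs.1], by linarith [hs.2]⟩
  have hlt : a - τ < b - τ := by linarith [h.1]
  refine ⟨hlt, h.2.1.comp ((contDiff_id.add contDiff_const).contMDiff.contMDiffOn) hmaps,
    fun s hs ↦ ?_⟩
  have hmd : MDifferentiableWithinAt 𝓘(ℝ, ℝ) 𝓘(ℝ, E) γ (Icc a b) (s + τ) :=
    (h.2.1 _ (hmaps hs)).mdifferentiableWithinAt (by simpa using hr)
  have h1 : HasMFDerivWithinAt 𝓘(ℝ, ℝ) 𝓘(ℝ, ℝ) (fun s : ℝ ↦ s + τ) (Icc (a - τ) (b - τ)) s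
      (ContinuousLinearMap.id ℝ ℝ) :=
    ((hasFDerivAt_id s).add_const τ).hasMFDerivAt.hasMFDerivWithinAt
  have h2 := (hmd.hasMFDerivWithinAt.comp s h1
    (show Icc (a - τ) (b - τ) ⊆ (fun s : ℝ ↦ s + τ) ⁻¹' Icc a b from hmaps)).mfderivWithin
    (uniqueDiffOn_Icc hlt s hs).uniqueMDiffWithinAt
  have h3 := congrArg (fun L : ℝ →L[ℝ] E ↦ L 1) h2
  exact mem_of_eq_base rfl h3 (h.2.2 _ (hmaps hs))

theorem IsPiecewiseCurve.congr {γ γ' : ℝ → M} {a b : ℝ} (h : IsPiecewiseCurve r D γ a b)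
    (he : EqOn γ' γ (Icc a b)) : IsPiecewiseCurve r D γ' a b := by
  obtain ⟨hab, n, t, h0, hn, ht⟩ := h
  exact ⟨hab, n, t, h0, hn, fun i hi ↦ IsSmoothPiece.congr (ht i hi)
    (he.mono (Icc_subset_of_partition h0 hn (fun i hi ↦ (ht i hi).1) hi))⟩

theorem IsPiecewiseCurve.comp_add {γ : ℝ → M} {a b : ℝ} (h : IsPiecewiseCurve r D γ a b)
    (hr : r ≠ 0) (τ : ℝ) : IsPiecewiseCurve r D (fun s ↦ γ (s + τ)) (a - τ) (b - τ) := by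
  obtain ⟨hab, n, t, h0, hn, ht⟩ := h
  exact ⟨by linarith, n, fun i ↦ t i - τ, by simp only [h0], by simp only [hn], fun i hi ↦
    IsSmoothPiece.comp_add (ht i hi) hr τ⟩

theorem IsPiecewiseCurve.trans {γ : ℝ → M} {a b c : ℝ} (h₁ : IsPiecewiseCurve r D γ a b)
    (h₂ : IsPiecewiseCurve r D γ b c) : IsPiecewiseCurve r D γ a c := by
  obtain ⟨hab, n, t, h0, hn, ht⟩ := h₁
  obtain ⟨hbc, m, u, hu0, hm, hu⟩ := h₂
  have hm' := pos_of_partition hbc hu0 hm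
  refine ⟨hab.trans hbc, n + m, fun i ↦ if i ≤ n then t i else u (i - n), by simpa, ?_,
    fun i hi ↦ ?_⟩
  · simpa [hm'.ne'] using hm
  · rcases lt_or_ge i n with h | h
    · simpa only [h.le, Nat.succ_le_of_lt h, if_true] using ht i h
    · have h1 : ¬ i + 1 ≤ n := by omega
      have h2 : (if i ≤ n then t i else u (i - n)) = u (i - n) := by
        split_ifs with h3
        · rw [le_antisymm h3 h, hn, Nat.sub_self, hu0]
        · rfl
      have h3 : i + 1 - n = i - n + 1 := by omega
      simpa only [h1, h2, h3, if_false] using hu (i - n) (by omega)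

/-- Piecewise curves can be concatenated. -/
theorem IsPiecewiseCurve.exists_concat (hr : r ≠ 0) {γ₁ γ₂ : ℝ → M} {a b c d : ℝ}
    (h₁ : IsPiecewiseCurve r D γ₁ a b) (h₂ : IsPiecewiseCurve r D γ₂ c d) (h : γ₁ b = γ₂ c) :
    ∃ (γ : ℝ → M) (a' b' : ℝ), IsPiecewiseCurve r D γ a' b' ∧ γ a' = γ₁ a ∧ γ b' = γ₂ d := by
  have hab := h₁.1
  have hcd := h₂.1
  have h₂' := h₂.comp_add hr (c - b)
  rw [sub_sub_cancel] at h₂'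
  refine ⟨fun s ↦ if s ≤ b then γ₁ s else γ₂ (s + (c - b)), a, d - (c - b),
    (h₁.congr fun s hs ↦ if_pos hs.2).trans (h₂'.congr fun s hs ↦ ?_), if_pos hab.le, ?_⟩
  · rcases hs.1.eq_or_lt with rfl | hs
    · simp [h]
    · exact if_neg hs.not_ge
  · simp only [sub_add_cancel]
    exact if_neg (by linarith)

namespace TimeOrientation

variable [IsManifold 𝓘(ℝ, E) 1 M] {g : LorentzianMetric k E M} {T : TimeOrientation g}

theorem Causal.trans {x y z : M} (h₁ : T.Causal x y) (h₂ : T.Causal y z) : T.Causal x z := by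
  rcases h₁ with rfl | ⟨γ₁, a, b, hγ₁, rfl, rfl⟩
  · exact h₂
  · rcases h₂ with rfl | ⟨γ₂, c, d, hγ₂, hc, rfl⟩
    · exact Or.inr ⟨γ₁, a, b, hγ₁, rfl, rfl⟩
    · obtain ⟨γ, a', b', hγ, ha', hb'⟩ := IsPiecewiseCurve.exists_concat (by simp) hγ₁ hγ₂ hc.symm
      exact Or.inr ⟨γ, a', b', hγ, ha', hb'⟩

theorem horismosChain_iff_reflTransGen {x y : M} :
    T.HorismosChain x y ↔ Relation.ReflTransGen T.Horismos x y := by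
  constructor
  · rintro ⟨n, z, rfl, rfl, h⟩
    induction n with
    | zero => exact .refl
    | succ n ih => exact (ih fun i hi ↦ h i (by omega)).tail (h n (by omega))
  · intro h
    induction h with
    | refl => exact ⟨0, fun _ ↦ x, rfl, rfl, by simp⟩
    | @tail b c _ hbc ih =>
      obtain ⟨n, z, h0, hn, hz⟩ := ih
      refine ⟨n + 1, fun i ↦ if i ≤ n then z i else c, by simpa, by simp, fun i hi ↦ ?_⟩
      rcases (Nat.lt_succ_iff.1 hi).eq_or_lt with rfl | hi
      · simpa [hn] using hbc
      · simpa only [hi.le, Nat.succ_le_of_lt hi, if_true] using hz i hi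

theorem HorismosChain.causal {x y : M} (h : T.HorismosChain x y) : T.Causal x y := by
  rw [horismosChain_iff_reflTransGen] at h
  induction h with
  | refl => exact Or.inl rfl
  | tail _ h ih => exact ih.trans h.1

/-- The end points of a timelike `C^(k+1)` curve in a strongly causal spacetime are joined by a horismotic
chain. -/
theorem StronglyCausal.reflTransGen_of_isSmoothPiece [FiniteDimensional ℝ E] (hk : 2 ≤ k)
    (hdim : 2 ≤ Module.finrank ℝ E) [IsManifold 𝓘(ℝ, E) ((k + 1 : ℕ∞) : WithTop ℕ∞) M]
    (hT : T.StronglyCausal) {γ : ℝ → M} {a b : ℝ}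
    (h : IsSmoothPiece (k + 1) (fun p ↦ {v | v ∈ T.future p ∧ g.IsTimelike v}) γ a b) :
    Relation.ReflTransGen T.Horismos (γ a) (γ b) := by
  obtain ⟨hab, hsm, htan⟩ := h
  have hloc : ∀ c ∈ Icc a b, ∀ᶠ t in 𝓝[Icc a b] c,
      (c < t → Relation.ReflTransGen T.Horismos (γ c) (γ t)) ∧
      (t < c → Relation.ReflTransGen T.Horismos (γ t) (γ c)) := fun c hc ↦
    hT.eventually_chain hk hdim ((hsm c hc).mdifferentiableWithinAt (by simp))
      (htan c hc).1 (htan c hc).2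
  -- At the supremum of `A`, the chains arriving from earlier parameters show that it is attained;
  -- the chains leaving it show that it cannot lie before `b`.
  set A := {t ∈ Icc a b | Relation.ReflTransGen T.Horismos (γ a) (γ t)} with hA
  have haA : a ∈ A := ⟨left_mem_Icc.2 hab.le, .refl⟩
  have hbdd : BddAbove A := ⟨b, fun t ht ↦ ht.1.2⟩
  have hlub := isLUB_csSup ⟨a, haA⟩ hbdd
  set c := sSup A
  have hc : c ∈ Icc a b := ⟨hlub.1 haA, hlub.2 fun t ht ↦ ht.1.2⟩
  obtain ⟨ε, hε, hball⟩ := Metric.mem_nhdsWithin_iff.1 (hloc c hc)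
  have hcA : c ∈ A := by
    obtain ⟨t, htA, ht, htc⟩ := hlub.exists_between (sub_lt_self c hε)
    rcases htc.eq_or_lt with rfl | hlt
    · exact htA
    · have := hball ⟨by rw [Metric.mem_ball, Real.dist_eq, abs_lt]; constructor <;> linarith, htA.1⟩
      exact ⟨hc, htA.2.trans (this.2 hlt)⟩
  rcases hc.2.eq_or_lt with heq | hlt
  · rw [← heq]
    exact hcA.2
  · exfalso
    obtain ⟨t, h1, h2⟩ := exists_between (lt_min hlt (lt_add_of_pos_right c hε))
    have htb : t ∈ Icc a b := ⟨hc.1.trans h1.le, (h2.trans_le (min_le_left _ _)).le⟩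
    have h3 := h2.trans_le (min_le_right _ _)
    have := hball ⟨by rw [Metric.mem_ball, Real.dist_eq, abs_lt]; constructor <;> linarith, htb⟩
    exact h1.not_ge (hlub.1 ⟨htb, hcA.2.trans (this.1 h1)⟩)

theorem StronglyCausal.reflTransGen_of_chron [FiniteDimensional ℝ E] (hk : 2 ≤ k)
    (hdim : 2 ≤ Module.finrank ℝ E) [IsManifold 𝓘(ℝ, E) ((k + 1 : ℕ∞) : WithTop ℕ∞) M]
    (hT : T.StronglyCausal) {x y : M} (h : T.Chron x y) :
    Relation.ReflTransGen T.Horismos x y := by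
  obtain ⟨γ, a, b, ⟨-, n, t, rfl, rfl, ht⟩, rfl, rfl⟩ := h
  induction n with
  | zero => exact .refl
  | succ n ih =>
    have h1 := ih fun i hi ↦ ht i (by omega)
    exact h1.trans (hT.reflTransGen_of_isSmoothPiece hk hdim (ht n (by omega)))

end TimeOrientation

end

end Lorentz

theorem mainTheorem10
    {k : ℕ∞} (hk : 2 ≤ k)
    {E : Type*} [NormedAddCommGroup E] [NormedSpace ℝ E] [FiniteDimensional ℝ E]
    (hdim : 2 ≤ Module.finrank ℝ E)
    {M : Type*} [TopologicalSpace M] [T2Space M] [ParacompactSpace M] [ConnectedSpace M]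
    [ChartedSpace E M] [IsManifold 𝓘(ℝ, E) 1 M]
    [IsManifold 𝓘(ℝ, E) ((k + 1 : ℕ∞) : WithTop ℕ∞) M]
    (g : Lorentz.LorentzianMetric k E M) (T : Lorentz.TimeOrientation g)
    (hT : T.StronglyCausal) (x y : M) :
    T.HorismosChain x y ↔ T.Causal x y := by
  refine ⟨fun h ↦ h.causal, fun h ↦ ?_⟩
  rw [Lorentz.TimeOrientation.horismosChain_iff_reflTransGen]
  -- Without chronological relation the causal relation is itself one horismotic step, also when `x
  -- = y`.
  by_cases hxy : T.Chron x y
  · exact hT.reflTransGen_of_chron hk hdim hxy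
  · exact .single ⟨h, hxy⟩
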